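/- Let $G$ be a finite group. Let $\mathrm{Tam}_G$ be the category of Tambara functors on $G$ (functors $T=(T^*,T_+,T_\bullet)$ on finite $G$-sets with values in commutative rings, with restrictions, additive transfers and multiplicative transfers), let $\mathrm{SMack}_G$ be the category of semi-Mackey functors on $G$ (with values in commutative monoids), and let $T\mapsto T^\mu=(T^*,T_\bullet)$ be the functor $\mathrm{Tam}_G\to\mathrm{SMack}_G$ taking the multiplicative part. For a Tambara functor $T$, a $T$-Tambara functor is a Tambara functor $S$ with a morphism $T\to S$ in $\mathrm{Tam}_G$; morphisms of $T$-Tambara functors are morphisms under $T$, and they form the category $T\text{-}\mathrm{Tam}_G$. Then the category $\mathrm{Tam}_G$ has binary coproducts, written $T\otimes_\Omega S$; the functor $(-)^\mu$ has a left adjoint $M\mapsto\Omega[M]$ (Tambarization); and the functor $\mathrm{SMack}_G\to\mathrm{Mon}$, $M\mapsto M(G/e)^G$, to commutative monoids has a left adjoint $Q\mapsto\mathcal L^G_Q$. Put $\mathcal F(T,M)=T\otimes_\Omega\Omega[M]$, a $T$-Tambara functor through the coproduct inclusion. Let $\mathfrak A^\alpha$ be the additive part of the Burnside semi-ring functor: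 $\mathfrak A^\alpha(X)$ is the monoid, under disjoint union, of isomorphism classes of finite $G$-sets over $X$, with pull-back as restriction and composition as transfer. Define functors $\mathrm{Tam}_G\to\mathrm{Tam}_G$ by $$T\mapsto T[\mathbf X]=\mathcal F(T,\mathfrak A^\alpha),\qquad T\mapsto T[\mathbf x]=\mathcal F(T,\mathcal L^G_{\mathbb N}).$$ 1. There is a bijection $T\text{-}\mathrm{Tam}_G(T[\mathbf X],S)\cong S(G/G)$ for each Tambara functor $T$ and each $T$-Tambara functor $S$, natural in $T$ and $S$. 2. There is a bijection $T\text{-}\mathrm{Tam}_G(T[\mathbf x],S)\cong S(G/e)^G$ for each Tambara functor $T$ and each $T$-Tambara functor $S$, natural in $T$ and $S$. 3. If $G$ is trivial, then evaluation $T\mapsto T(G/G)$ (respectively $T\mapsto T(G/e)$) is an equivalence from $\mathrm{Tam}_G$ to the category of commutative rings, and under it the functor $T\mapsto T[\mathbf X]$ (respectively $T\mapsto T[\mathbf x]$) agrees with the polynomial ring functor $R\mapsto R[\mathbf X]$: there is an isomorphism $T[\mathbf X](G/G)\cong T(G/G)[\mathbf X]$ (respectively $T[\mathbf x](G/e)\cong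 T(G/e)[\mathbf X]$), natural in $T$, that sends the image of $r\in T(G/G)$ (respectively $r\in T(G/e)$) to the constant polynomial $r$ and sends the element corresponding to the identity morphism, under the bijection of 1 (respectively 2), to the indeterminate $\mathbf X$. -/

import Mathlib

open CategoryTheory CategoryTheory.Limits

universe u w

/-! ### Finite `G`-sets -/

/-- A finite set with a left action of `G`. -/
structure FinGSet (G : Type u) [Group G] : Type (u + 1) where
  carrier : Type u
  [action : MulAction G carrier]
  [finite : Finite carrier]

namespace FinGSet

variable {G : Type u} [Group G]

instance : CoeSort (FinGSet G) (Type u) := ⟨FinGSet.carrier⟩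

attribute [instance] FinGSet.action FinGSet.finite

/-- A `G`-equivariant map. -/
@[ext]
structure Hom (X Y : FinGSet G) : Type u where
  toFun : X → Y
  map_smul : ∀ (g : G) (x : X), toFun (g • x) = g • toFun x

/-- The category of finite `G`-sets and `G`-equivariant maps. -/
instance : Category (FinGSet G) where
  Hom X Y := Hom X Y
  id X := ⟨fun x => x, fun _ _ => rfl⟩
  comp f h := ⟨fun x => h.toFun (f.toFun x), fun g x => by rw [f.map_smul, h.map_smul]⟩

instance (X Y : FinGSet G) : FunLike (X ⟶ Y) X Y where
  coe f := Hom.toFun f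
  coe_injective _ _ e := Hom.ext e

/-- The equivariant map with given underlying function. -/
def mkHom {X Y : FinGSet G} (f : X → Y) (hf : ∀ (g : G) (x : X), f (g • x) = g • f x) : X ⟶ Y :=
  ⟨f, hf⟩

@[simp] theorem mkHom_apply {X Y : FinGSet G} (f : X → Y) (hf) (x : X) :
    (mkHom f hf : X ⟶ Y) x = f x := rfl

@[simp] theorem id_apply {X : FinGSet G} (x : X) : (𝟙 X : X ⟶ X) x = x := rfl

@[simp] theorem comp_apply {X Y Z : FinGSet G} (f : X ⟶ Y) (h : Y ⟶ Z) (x : X) :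
    (f ≫ h) x = h (f x) := rfl

theorem hom_smul {X Y : FinGSet G} (f : X ⟶ Y) (g : G) (x : X) : f (g • x) = g • f x :=
  Hom.map_smul f g x

theorem hom_ext {X Y : FinGSet G} {f h : X ⟶ Y} (e : ∀ x, f x = h x) : f = h :=
  DFunLike.ext f h e

/-- An equivariant bijection is an isomorphism. -/
def isoOfEquiv {X Y : FinGSet G} (e : X ≃ Y) (he : ∀ (g : G) (x : X), e (g • x) = g • e x) :
    X ≅ Y where
  hom := mkHom e he
  inv := mkHom e.symm (fun g y => by rw [Equiv.symm_apply_eq, he, Equiv.apply_symm_apply])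
  hom_inv_id := hom_ext fun x => e.symm_apply_apply x
  inv_hom_id := hom_ext fun y => e.apply_symm_apply y

/-- The empty `G`-set. -/
def empty (G : Type u) [Group G] : FinGSet G where
  carrier := PEmpty
  action :=
    { smul := fun _ x => x
      one_smul := fun _ => rfl
      mul_smul := fun _ _ _ => rfl }

/-- The one-point `G`-set `G/G`. -/
def point (G : Type u) [Group G] : FinGSet G where
  carrier := PUnit
  action :=
    { smul := fun _ x => x
      one_smul := fun _ => rfl
      mul_smul := fun _ _ _ => rfl }

/-- The `G`-set `G/e`, that is, `G` acting on itself by left multiplication. -/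
def regular (G : Type u) [Group G] [Finite G] : FinGSet G where
  carrier := G

/-- Right multiplication by `g`, a `G`-equivariant automorphism of `G/e`. -/
def rightMul [Finite G] (g : G) : regular G ⟶ regular G :=
  mkHom (X := regular G) (Y := regular G) (fun x => (show G from x) * g)
    (fun h x => mul_assoc h (show G from x) g)

/-- The disjoint union of two finite `G`-sets. -/
def sum (X Y : FinGSet G) : FinGSet G where
  carrier := X ⊕ Y
  action :=
    { smul := fun g => Sum.map (fun x => g • x) (fun y => g • y)
      one_smul := by rintro (x | y) <;> simp [HSMul.hSMul] <;> exact one_smul G _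
      mul_smul := by
        rintro g h (x | y) <;> simp [HSMul.hSMul] <;> exact mul_smul g h _ }

theorem sum_smul_inl {X Y : FinGSet G} (g : G) (x : X) :
    g • (Sum.inl x : sum X Y) = (Sum.inl (g • x) : X ⊕ Y) := rfl

theorem sum_smul_inr {X Y : FinGSet G} (g : G) (y : Y) :
    g • (Sum.inr y : sum X Y) = (Sum.inr (g • y) : X ⊕ Y) := rfl

/-- The first inclusion into a disjoint union. -/
def inl (X Y : FinGSet G) : X ⟶ sum X Y := mkHom (Y := sum X Y) Sum.inl (fun _ _ => rfl)

/-- The second inclusion into a disjoint union. -/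
def inr (X Y : FinGSet G) : Y ⟶ sum X Y := mkHom (Y := sum X Y) Sum.inr (fun _ _ => rfl)

/-- The map out of a disjoint union given by a pair of maps. -/
def sumDesc {X Y Z : FinGSet G} (f : X ⟶ Z) (h : Y ⟶ Z) : sum X Y ⟶ Z :=
  mkHom (X := sum X Y) (Sum.elim f h) (by
    rintro g (x | y)
    · exact hom_smul f g x
    · exact hom_smul h g y)

/-- The canonical pull-back `X ×_Y Z` of `f : X ⟶ Y` and `h : Z ⟶ Y`. -/
def fiberProd {X Y Z : FinGSet G} (f : X ⟶ Y) (h : Z ⟶ Y) : FinGSet G where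
  carrier := {t : X × Z // f t.1 = h t.2}
  action :=
    { smul := fun g t => ⟨(g • t.1.1, g • t.1.2), by
        simp only [hom_smul]; rw [t.2]⟩
      one_smul := fun t => Subtype.ext (Prod.ext (one_smul G t.1.1) (one_smul G t.1.2))
      mul_smul := fun g k t =>
        Subtype.ext (Prod.ext (mul_smul g k t.1.1) (mul_smul g k t.1.2)) }

/-- The first projection from `X ×_Y Z`. -/
def fiberFst {X Y Z : FinGSet G} (f : X ⟶ Y) (h : Z ⟶ Y) : fiberProd f h ⟶ X :=
  mkHom (X := fiberProd f h) (fun t => t.1.1) (fun _ _ => rfl)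

/-- The second projection from `X ×_Y Z`. -/
def fiberSnd {X Y Z : FinGSet G} (f : X ⟶ Y) (h : Z ⟶ Y) : fiberProd f h ⟶ Z :=
  mkHom (X := fiberProd f h) (fun t => t.1.2) (fun _ _ => rfl)

theorem isPullback_fiberProd {X Y Z : FinGSet G} (f : X ⟶ Y) (h : Z ⟶ Y) :
    IsPullback (fiberFst f h) (fiberSnd f h) f h :=
  { w := hom_ext fun t => t.2
    isLimit' := ⟨PullbackCone.IsLimit.mk _
      (fun s => mkHom (Y := fiberProd f h)
        (fun x => ⟨(s.fst x, s.snd x), DFunLike.congr_fun s.condition x⟩)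
        (fun g x => Subtype.ext (Prod.ext (hom_smul s.fst g x) (hom_smul s.snd g x))))
      (fun _ => rfl) (fun _ => rfl)
      (fun _ _ h₁ h₂ => hom_ext fun x => Subtype.ext (Prod.ext
        (DFunLike.congr_fun h₁ x) (DFunLike.congr_fun h₂ x)))⟩ }

/-- A pull-back square of finite `G`-sets is one on underlying sets. -/
theorem existsUnique_of_isPullback {P X Y Z : FinGSet G} {a : P ⟶ X} {b : P ⟶ Z} {f : X ⟶ Y}
    {h : Z ⟶ Y} (sq : IsPullback a b f h) (x : X) (z : Z) (e : f x = h z) :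
    ∃! c : P, a c = x ∧ b c = z := by
  let i := sq.isoIsPullback X Z (isPullback_fiberProd f h)
  have h1 : i.inv ≫ a = fiberFst f h := sq.isoIsPullback_inv_fst _ _ _
  have h2 : i.inv ≫ b = fiberSnd f h := sq.isoIsPullback_inv_snd _ _ _
  have h3 : i.hom ≫ fiberFst f h = a := sq.isoIsPullback_hom_fst _ _ _
  have h4 : i.hom ≫ fiberSnd f h = b := sq.isoIsPullback_hom_snd _ _ _
  refine ⟨i.inv (show fiberProd f h from ⟨(x, z), e⟩), ⟨?_, ?_⟩, ?_⟩
  · exact DFunLike.congr_fun h1 (show fiberProd f h from ⟨(x, z), e⟩)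
  · exact DFunLike.congr_fun h2 (show fiberProd f h from ⟨(x, z), e⟩)
  · rintro c ⟨hx, hz⟩
    have : i.hom c = (show fiberProd f h from ⟨(x, z), e⟩) := by
      refine Subtype.ext (Prod.ext ?_ ?_)
      · exact (DFunLike.congr_fun h3 c).trans hx
      · exact (DFunLike.congr_fun h4 c).trans hz
    rw [← this]
    exact (DFunLike.congr_fun i.hom_inv_id c).symm

/-! ### Exponential diagrams -/

/-- The pairs `(y, σ)` with `y ∈ Y` and `σ : f⁻¹(y) → A` a map of sets such that `p ∘ σ` is the
identity on `f⁻¹(y)`. -/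
abbrev Sections {A X Y : FinGSet G} (f : X ⟶ Y) (p : A ⟶ X) : Type u :=
  Σ y : Y, {σ : {x : X // f x = y} → A // ∀ x, p (σ x) = x.1}

theorem Sections.ext {A X Y : FinGSet G} {f : X ⟶ Y} {p : A ⟶ X} {s t : Sections f p}
    (h₁ : s.1 = t.1)
    (h₂ : ∀ (x : X) (hs : f x = s.1) (ht : f x = t.1), s.2.1 ⟨x, hs⟩ = t.2.1 ⟨x, ht⟩) :
    s = t := by
  obtain ⟨y, σ, hσ⟩ := s
  obtain ⟨y', τ, hτ⟩ := t
  obtain rfl : y = y' := h₁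
  obtain rfl : σ = τ := funext fun x => h₂ x.1 x.2 x.2
  rfl

/-- The finite `G`-set `Π_f(A)`, with `g • (y, σ) = (g • y, x ↦ g • σ (g⁻¹ • x))`. -/
def piSet {A X Y : FinGSet G} (f : X ⟶ Y) (p : A ⟶ X) : FinGSet G where
  carrier := Sections f p
  action :=
    { smul := fun g s => ⟨g • s.1,
        fun x => g • s.2.1 ⟨g⁻¹ • x.1, by rw [hom_smul, x.2, inv_smul_smul]⟩,
        fun x => by rw [hom_smul, s.2.2, smul_inv_smul]⟩
      one_smul := fun s => Sections.ext (one_smul G s.1) (fun x hs ht => by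
        change (1 : G) • s.2.1 ⟨(1 : G)⁻¹ • x, _⟩ = _
        simp)
      mul_smul := fun g k s => Sections.ext (mul_smul g k s.1) (fun x hs ht => by
        change (g * k) • s.2.1 ⟨(g * k)⁻¹ • x, _⟩ = g • k • s.2.1 ⟨k⁻¹ • g⁻¹ • x, _⟩
        simp only [mul_smul, mul_inv_rev]) }

/-- The projection `π : Π_f(A) ⟶ Y`, `(y, σ) ↦ y`. -/
def piProj {A X Y : FinGSet G} (f : X ⟶ Y) (p : A ⟶ X) : piSet f p ⟶ Y :=
  mkHom (X := piSet f p) (fun s => s.1) (fun _ _ => rfl)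

/-- The evaluation `e : X ×_Y Π_f(A) ⟶ A`, `(x, (y, σ)) ↦ σ x`. -/
def piEval {A X Y : FinGSet G} (f : X ⟶ Y) (p : A ⟶ X) : fiberProd f (piProj f p) ⟶ A :=
  mkHom (X := fiberProd f (piProj f p)) (fun t => t.1.2.2.1 ⟨t.1.1, t.2⟩) (fun g t => by
    change g • t.1.2.2.1 ⟨g⁻¹ • g • t.1.1, _⟩ = g • t.1.2.2.1 ⟨t.1.1, t.2⟩
    simp only [inv_smul_smul])

/-- The diagram `X ←p A ←lam Z ⟶rho B ⟶q Y`, together with `f : X ⟶ Y`, is an exponential diagram: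
it is isomorphic to the canonical one generated by `f` and `p`. -/
def IsExponential {A X Y Z B : FinGSet G} (f : X ⟶ Y) (p : A ⟶ X) (lam : Z ⟶ A) (rho : Z ⟶ B)
    (q : B ⟶ Y) : Prop :=
  ∃ (i : Z ≅ fiberProd f (piProj f p)) (j : B ≅ piSet f p),
    i.hom ≫ piEval f p = lam ∧ i.hom ≫ fiberSnd f (piProj f p) = rho ≫ j.hom ∧
      j.hom ≫ piProj f p = q

end FinGSet

/-! ### Semi-Mackey functors -/

/-- A semi-Mackey functor on `G`, with values in commutative monoids (written multiplicatively). -/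
structure SemiMackeyFunctor (G : Type u) [Group G] : Type (max (u + 1) (w + 1)) where
  obj : FinGSet G → Type w
  [monoid : ∀ X, CommMonoid (obj X)]
  /-- restriction -/
  res : ∀ {X Y : FinGSet G}, (X ⟶ Y) → (obj Y →* obj X)
  /-- transfer -/
  tr : ∀ {X Y : FinGSet G}, (X ⟶ Y) → (obj X →* obj Y)
  res_id : ∀ (X : FinGSet G) (m : obj X), res (𝟙 X) m = m
  res_comp : ∀ {X Y Z : FinGSet G} (f : X ⟶ Y) (h : Y ⟶ Z) (m : obj Z),
    res (f ≫ h) m = res f (res h m)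
  tr_id : ∀ (X : FinGSet G) (m : obj X), tr (𝟙 X) m = m
  tr_comp : ∀ {X Y Z : FinGSet G} (f : X ⟶ Y) (h : Y ⟶ Z) (m : obj X),
    tr (f ≫ h) m = tr h (tr f m)
  /-- the contravariant part sends the initial object to a one-point set -/
  additive_empty : Subsingleton (obj (FinGSet.empty G))
  /-- the contravariant part sends binary coproducts to products -/
  additive_sum : ∀ X Y : FinGSet G, Function.Bijective
    (fun m : obj (FinGSet.sum X Y) => (res (FinGSet.inl X Y) m, res (FinGSet.inr X Y) m))
  mackey : ∀ {X' Y' X Y : FinGSet G} {f' : X' ⟶ Y'} {x : X' ⟶ X} {y : Y' ⟶ Y} {f : X ⟶ Y},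
    IsPullback f' x y f → ∀ m : obj Y', res f (tr y m) = tr x (res f' m)

namespace SemiMackeyFunctor

variable {G : Type u} [Group G]

attribute [instance] SemiMackeyFunctor.monoid

/-- A morphism of semi-Mackey functors. -/
@[ext]
structure Hom (M N : SemiMackeyFunctor.{u, w} G) : Type (max (u + 1) w) where
  app : ∀ X : FinGSet G, M.obj X →* N.obj X
  app_res : ∀ {X Y : FinGSet G} (f : X ⟶ Y) (m : M.obj Y), app X (M.res f m) = N.res f (app Y m)
  app_tr : ∀ {X Y : FinGSet G} (f : X ⟶ Y) (m : M.obj X), app Y (M.tr f m) = N.tr f (app X m)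

/-- The category `SMack_G`. -/
instance : Category (SemiMackeyFunctor.{u, w} G) where
  Hom M N := Hom M N
  id M := ⟨fun X => MonoidHom.id (M.obj X), fun _ _ => rfl, fun _ _ => rfl⟩
  comp φ ψ := ⟨fun X => (ψ.app X).comp (φ.app X),
    fun f m => by simp [φ.app_res, ψ.app_res], fun f m => by simp [φ.app_tr, ψ.app_tr]⟩

/-- The `G`-fixed part of `M(G/e)`, where `g ∈ G` acts as the restriction along the automorphism
`x ↦ x g` of `G/e`. -/
def fixedPart [Finite G] (M : SemiMackeyFunctor.{u, w} G) : Submonoid (M.obj (FinGSet.regular G)) where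
  carrier := {m | ∀ g : G, M.res (FinGSet.rightMul g) m = m}
  one_mem' := fun _ => map_one _
  mul_mem' := fun {a b} ha hb g => by rw [map_mul, ha g, hb g]

/-- The functor `M ↦ M(G/e)^G` from semi-Mackey functors to commutative monoids. -/
def evFixed (G : Type u) [Group G] [Finite G] :
    SemiMackeyFunctor.{u, w} G ⥤ CommMonCat.{w} where
  obj M := CommMonCat.of (fixedPart M)
  map {M N} φ := CommMonCat.ofHom
    (((Hom.app φ (FinGSet.regular G)).comp (fixedPart M).subtype).codRestrict (fixedPart N)
      (fun m g => by
        change N.res _ (Hom.app φ _ m.1) = Hom.app φ _ m.1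
        rw [← Hom.app_res, m.2 g]))
  map_id _ := rfl
  map_comp _ _ := rfl

end SemiMackeyFunctor

/-! ### The Burnside semi-ring functor -/

namespace Burnside

variable {G : Type u} [Group G]

open FinGSet

/-- The set `cl(Gs/X)` of isomorphism classes of finite `G`-sets over `X`. -/
def IsoClass (X : FinGSet G) : Type (u + 1) := Quotient (isIsomorphicSetoid (Over X))

/-- The isomorphism class of `a : A ⟶ X`. -/
def cls {A X : FinGSet G} (a : A ⟶ X) : IsoClass X := Quotient.mk _ (Over.mk a)

theorem cls_eq {A B X : FinGSet G} {a : A ⟶ X} {b : B ⟶ X} (i : A ≅ B)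
    (h : ∀ x, b (i.hom x) = a x) : cls a = cls b :=
  Quotient.sound ⟨Over.isoMk i (hom_ext h)⟩

theorem cls_eq_of_equiv {A B X : FinGSet G} {a : A ⟶ X} {b : B ⟶ X} (e : A ≃ B)
    (he : ∀ (g : G) (x : A), e (g • x) = g • e x) (h : ∀ x, b (e x) = a x) : cls a = cls b :=
  cls_eq (isoOfEquiv e he) h

theorem cls_exact {A B X : FinGSet G} {a : A ⟶ X} {b : B ⟶ X} (h : cls a = cls b) :
    ∃ i : A ≅ B, ∀ x, b (i.hom x) = a x := by
  obtain ⟨i⟩ := Quotient.exact h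
  exact ⟨(Over.forget X).mapIso i, fun x => DFunLike.congr_fun (Over.w i.hom) x⟩

theorem cls_ind {X : FinGSet G} {P : IsoClass X → Prop}
    (h : ∀ (A : FinGSet G) (a : A ⟶ X), P (cls a)) (c : IsoClass X) : P c :=
  Quotient.inductionOn c fun a => h a.left a.hom

/-- The unique map from the empty set. -/
def fromEmpty (X : FinGSet G) : FinGSet.empty G ⟶ X :=
  mkHom (X := FinGSet.empty G) (fun x => PEmpty.elim x) (fun _ x => PEmpty.elim x)

/-- Disjoint union of isomorphic families. -/
def sumIso {A A' B B' : FinGSet G} (i : A ≅ A') (j : B ≅ B') : FinGSet.sum A B ≅ FinGSet.sum A' B' where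
  hom := sumDesc (i.hom ≫ inl A' B') (j.hom ≫ inr A' B')
  inv := sumDesc (i.inv ≫ inl A B) (j.inv ≫ inr A B)
  hom_inv_id := hom_ext (by
    rintro (x | x)
    · exact congrArg Sum.inl (DFunLike.congr_fun i.hom_inv_id x)
    · exact congrArg Sum.inr (DFunLike.congr_fun j.hom_inv_id x))
  inv_hom_id := hom_ext (by
    rintro (x | x)
    · exact congrArg Sum.inl (DFunLike.congr_fun i.inv_hom_id x)
    · exact congrArg Sum.inr (DFunLike.congr_fun j.inv_hom_id x))

/-- The sum of isomorphism classes, given by disjoint union. -/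
def add {X : FinGSet G} (c d : IsoClass X) : IsoClass X :=
  Quotient.map₂ (fun a b : Over X => Over.mk (sumDesc a.hom b.hom)) (by
    rintro a a' ⟨i⟩ b b' ⟨j⟩
    refine ⟨Over.isoMk (sumIso ((Over.forget X).mapIso i) ((Over.forget X).mapIso j)) (hom_ext ?_)⟩
    rintro (x | x)
    · exact DFunLike.congr_fun (Over.w i.hom) x
    · exact DFunLike.congr_fun (Over.w j.hom) x) c d

theorem add_cls {A B X : FinGSet G} (a : A ⟶ X) (b : B ⟶ X) :
    add (cls a) (cls b) = cls (sumDesc a b) := rfl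

/-- Isomorphism classes with disjoint union form a commutative monoid, here written
multiplicatively: the product is the class of `A ⊔ B ⟶ X`, the unit is the class of `∅ ⟶ X`. -/
instance (X : FinGSet G) : CommMonoid (IsoClass X) where
  mul := add
  one := cls (fromEmpty X)
  mul_assoc c d e := by
    induction c using cls_ind with | h A a
    induction d using cls_ind with | h B b
    induction e using cls_ind with | h C c
    refine cls_eq_of_equiv (Equiv.sumAssoc A B C) ?_ ?_
    · rintro g ((x | x) | x) <;> rfl
    · rintro ((x | x) | x) <;> rfl
  one_mul c := by
    induction c using cls_ind with | h A a
    refine cls_eq_of_equiv (Equiv.emptySum PEmpty A) ?_ ?_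
    · rintro g (x | x)
      · exact PEmpty.elim x
      · rfl
    · rintro (x | x)
      · exact PEmpty.elim x
      · rfl
  mul_one c := by
    induction c using cls_ind with | h A a
    refine cls_eq_of_equiv (Equiv.sumEmpty A PEmpty) ?_ ?_
    · rintro g (x | x)
      · rfl
      · exact PEmpty.elim x
    · rintro (x | x)
      · rfl
      · exact PEmpty.elim x
  mul_comm c d := by
    induction c using cls_ind with | h A a
    induction d using cls_ind with | h B b
    refine cls_eq_of_equiv (Equiv.sumComm A B) ?_ ?_
    · rintro g (x | x) <;> rfl
    · rintro (x | x) <;> rfl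

theorem mul_cls {A B X : FinGSet G} (a : A ⟶ X) (b : B ⟶ X) :
    cls a * cls b = cls (sumDesc a b) := rfl

theorem one_def (X : FinGSet G) : (1 : IsoClass X) = cls (fromEmpty X) := rfl

/-- Transfer: composition with `f`. -/
def tr {X Y : FinGSet G} (f : X ⟶ Y) : IsoClass X →* IsoClass Y where
  toFun := Quotient.map (fun a : Over X => Over.mk (a.hom ≫ f)) (by
    rintro a b ⟨i⟩
    exact ⟨Over.isoMk ((Over.forget X).mapIso i)
      (hom_ext fun x => congrArg f (DFunLike.congr_fun (Over.w i.hom) x))⟩)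
  map_one' := cls_eq (Iso.refl _) (fun x => PEmpty.elim x)
  map_mul' c d := by
    induction c using cls_ind with | h A a
    induction d using cls_ind with | h B b
    refine cls_eq (a := sumDesc a b ≫ f) (b := sumDesc (a ≫ f) (b ≫ f)) (Iso.refl _) ?_
    rintro (x | x) <;> rfl

theorem tr_cls {A X Y : FinGSet G} (f : X ⟶ Y) (a : A ⟶ X) : tr f (cls a) = cls (a ≫ f) := rfl

/-- Restriction: pull-back along `f`. -/
def res {X Y : FinGSet G} (f : X ⟶ Y) : IsoClass Y →* IsoClass X where
  toFun := Quotient.map (fun b : Over Y => Over.mk (fiberFst f b.hom)) (by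
    rintro a b ⟨i⟩
    have h1 : ∀ x, b.hom (i.hom.left x) = a.hom x := fun x => DFunLike.congr_fun (Over.w i.hom) x
    have h2 : ∀ x, a.hom (i.inv.left x) = b.hom x := fun x => DFunLike.congr_fun (Over.w i.inv) x
    have h3 : ∀ x, i.inv.left (i.hom.left x) = x := fun x =>
      DFunLike.congr_fun ((Over.forget Y).mapIso i).hom_inv_id x
    have h4 : ∀ x, i.hom.left (i.inv.left x) = x := fun x =>
      DFunLike.congr_fun ((Over.forget Y).mapIso i).inv_hom_id x
    exact Quotient.exact (cls_eq_of_equiv (A := fiberProd f a.hom) (B := fiberProd f b.hom)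
      ⟨fun t => ⟨(t.1.1, i.hom.left t.1.2), by rw [h1]; exact t.2⟩,
        fun t => ⟨(t.1.1, i.inv.left t.1.2), by rw [h2]; exact t.2⟩,
        fun t => Subtype.ext (Prod.ext rfl (h3 _)), fun t => Subtype.ext (Prod.ext rfl (h4 _))⟩
      (fun g t => Subtype.ext (Prod.ext rfl (hom_smul _ _ _))) (fun _ => rfl)))
  map_one' := cls_eq_of_equiv (A := fiberProd f (fromEmpty Y)) (B := FinGSet.empty G)
    ⟨fun t => t.1.2, fun x => PEmpty.elim x, fun t => PEmpty.elim t.1.2, fun x => PEmpty.elim x⟩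
    (fun _ t => PEmpty.elim t.1.2) (fun t => PEmpty.elim t.1.2)
  map_mul' c d := by
    induction c using cls_ind with | h A a
    induction d using cls_ind with | h B b
    refine cls_eq_of_equiv (A := fiberProd f (sumDesc a b))
      (B := FinGSet.sum (fiberProd f a) (fiberProd f b))
      ⟨fun t => match t with
        | ⟨(x, Sum.inl y), h⟩ => Sum.inl ⟨(x, y), h⟩
        | ⟨(x, Sum.inr y), h⟩ => Sum.inr ⟨(x, y), h⟩,
        fun t => match t with
        | Sum.inl s => ⟨(s.1.1, Sum.inl s.1.2), s.2⟩
        | Sum.inr s => ⟨(s.1.1, Sum.inr s.1.2), s.2⟩, ?_, ?_⟩ ?_ ?_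
    · rintro ⟨⟨x, y | y⟩, h⟩ <;> rfl
    · rintro (s | s) <;> rfl
    · rintro g ⟨⟨x, y | y⟩, h⟩ <;> rfl
    · rintro ⟨⟨x, y | y⟩, h⟩ <;> rfl

theorem res_cls {B X Y : FinGSet G} (f : X ⟶ Y) (b : B ⟶ Y) :
    res f (cls b) = cls (fiberFst f b) := rfl

theorem res_id (X : FinGSet G) (c : IsoClass X) : res (𝟙 X) c = c := by
  induction c using cls_ind with | h A a
  exact cls_eq_of_equiv (A := fiberProd (𝟙 X) a) (B := A)
    ⟨fun t => t.1.2, fun x => ⟨(a x, x), rfl⟩, fun t => Subtype.ext (Prod.ext t.2.symm rfl),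
      fun _ => rfl⟩ (fun _ _ => rfl) (fun t => t.2.symm)

theorem res_comp {X Y Z : FinGSet G} (f : X ⟶ Y) (h : Y ⟶ Z) (c : IsoClass Z) :
    res (f ≫ h) c = res f (res h c) := by
  induction c using cls_ind with | h A a
  exact cls_eq_of_equiv (A := fiberProd (f ≫ h) a) (B := fiberProd f (fiberFst h a))
    ⟨fun t => ⟨(t.1.1, ⟨(f t.1.1, t.1.2), t.2⟩), rfl⟩,
      fun t => ⟨(t.1.1, t.1.2.1.2), (congrArg h t.2).trans t.1.2.2⟩,
      fun _ => rfl, fun t => Subtype.ext (Prod.ext rfl (Subtype.ext (Prod.ext t.2 rfl)))⟩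
    (fun g t => Subtype.ext (Prod.ext rfl (Subtype.ext (Prod.ext (hom_smul f g t.1.1) rfl))))
    (fun _ => rfl)

theorem tr_id (X : FinGSet G) (c : IsoClass X) : tr (𝟙 X) c = c := by
  induction c using cls_ind with | h A a
  rfl

theorem tr_comp {X Y Z : FinGSet G} (f : X ⟶ Y) (h : Y ⟶ Z) (c : IsoClass X) :
    tr (f ≫ h) c = tr h (tr f c) := by
  induction c using cls_ind with | h A a
  rfl

theorem subsingleton_empty : Subsingleton (IsoClass (FinGSet.empty G)) := by
  have : ∀ c : IsoClass (FinGSet.empty G), c = 1 := fun c => by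
    induction c using cls_ind with | h A a
    exact cls_eq_of_equiv (A := A) (B := FinGSet.empty G)
      ⟨fun x => a x, fun x => PEmpty.elim x, fun x => PEmpty.elim (a x), fun x => PEmpty.elim x⟩
      (fun _ x => PEmpty.elim (a x)) (fun x => PEmpty.elim (a x))
  exact ⟨fun c d => (this c).trans (this d).symm⟩

theorem bijective_sum (X Y : FinGSet G) : Function.Bijective
    (fun c : IsoClass (FinGSet.sum X Y) =>
      (res (FinGSet.inl X Y) c, res (FinGSet.inr X Y) c)) := by
  -- every class over `X ⊔ Y` is recovered from its two restrictions
  have key : ∀ c : IsoClass (FinGSet.sum X Y),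
      tr (inl X Y) (res (inl X Y) c) * tr (inr X Y) (res (inr X Y) c) = c := fun c => by
    induction c using cls_ind with | h A a
    rw [res_cls, res_cls, tr_cls, tr_cls, mul_cls]
    let k : FinGSet.sum (fiberProd (inl X Y) a) (fiberProd (inr X Y) a) ⟶ A :=
      sumDesc (fiberSnd _ _) (fiberSnd _ _)
    have hk : ∀ t, a (k t) =
        sumDesc (fiberFst (inl X Y) a ≫ inl X Y) (fiberFst (inr X Y) a ≫ inr X Y) t := by
      rintro (t | t)
      · exact t.2.symm
      · exact t.2.symm
    refine cls_eq_of_equiv (Equiv.ofBijective k ⟨?_, ?_⟩) (fun g t => hom_smul k g t) hk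
    · rintro (t | t) (s | s) e
      · have h1 : t.1.2 = s.1.2 := e
        refine congrArg Sum.inl (Subtype.ext (Prod.ext (Sum.inl_injective (β := Y) ?_) h1))
        exact t.2.trans ((congrArg a h1).trans s.2.symm)
      · have h1 : t.1.2 = s.1.2 := e
        have : (Sum.inl t.1.1 : X ⊕ Y) = Sum.inr s.1.1 :=
          t.2.trans ((congrArg a h1).trans s.2.symm)
        cases this
      · have h1 : t.1.2 = s.1.2 := e
        have : (Sum.inr t.1.1 : X ⊕ Y) = Sum.inl s.1.1 :=
          t.2.trans ((congrArg a h1).trans s.2.symm)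
        cases this
      · have h1 : t.1.2 = s.1.2 := e
        refine congrArg Sum.inr (Subtype.ext (Prod.ext (Sum.inr_injective (α := X) ?_) h1))
        exact t.2.trans ((congrArg a h1).trans s.2.symm)
    · intro x
      rcases h : (show X ⊕ Y from a x) with y | y
      · exact ⟨Sum.inl ⟨(y, x), h.symm⟩, rfl⟩
      · exact ⟨Sum.inr ⟨(y, x), h.symm⟩, rfl⟩
  refine ⟨fun c d e => ?_, ?_⟩
  · have e1 : res (inl X Y) c = res (inl X Y) d := (Prod.ext_iff.1 e).1
    have e2 : res (inr X Y) c = res (inr X Y) d := (Prod.ext_iff.1 e).2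
    rw [← key c, ← key d, e1, e2]
  · rintro ⟨c, d⟩
    induction c using cls_ind with | h A a
    induction d using cls_ind with | h B b
    refine ⟨cls (sumDesc (a ≫ inl X Y) (b ≫ inr X Y)), Prod.ext ?_ ?_⟩
    · refine (cls_eq_of_equiv (A := A) (B := fiberProd (inl X Y) (sumDesc (a ≫ inl X Y) (b ≫ inr X Y)))
        ⟨fun x => ⟨(a x, Sum.inl x), rfl⟩,
        fun t => (match t with
          | ⟨(_, Sum.inl y), _⟩ => y
          | ⟨(_, Sum.inr _), h⟩ => by cases h), fun _ => rfl, ?_⟩ ?_ ?_).symm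
      · rintro ⟨⟨x, y | y⟩, h⟩
        · exact Subtype.ext (Prod.ext (Sum.inl_injective (β := Y) h.symm) rfl)
        · cases h
      · exact fun g x => Subtype.ext (Prod.ext (hom_smul a g x) rfl)
      · exact fun _ => rfl
    · refine (cls_eq_of_equiv (A := B) (B := fiberProd (inr X Y) (sumDesc (a ≫ inl X Y) (b ≫ inr X Y)))
        ⟨fun x => ⟨(b x, Sum.inr x), rfl⟩,
        fun t => (match t with
          | ⟨(_, Sum.inr y), _⟩ => y
          | ⟨(_, Sum.inl _), h⟩ => by cases h), fun _ => rfl, ?_⟩ ?_ ?_).symm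
      · rintro ⟨⟨x, y | y⟩, h⟩
        · cases h
        · exact Subtype.ext (Prod.ext (Sum.inr_injective (α := X) h.symm) rfl)
      · exact fun g x => Subtype.ext (Prod.ext (hom_smul b g x) rfl)
      · exact fun _ => rfl

theorem mackey {X' Y' X Y : FinGSet G} {f' : X' ⟶ Y'} {x : X' ⟶ X} {y : Y' ⟶ Y} {f : X ⟶ Y}
    (sq : IsPullback f' x y f) (c : IsoClass Y') : res f (tr y c) = tr x (res f' c) := by
  induction c using cls_ind with | h B b
  rw [res_cls, tr_cls, res_cls, tr_cls]
  have hw : ∀ t, y (f' t) = f (x t) := fun t => DFunLike.congr_fun sq.w t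
  let k : fiberProd f' b ⟶ fiberProd f (b ≫ y) :=
    mkHom (X := fiberProd f' b) (Y := fiberProd f (b ≫ y))
      (fun t => ⟨(x t.1.1, t.1.2), by rw [← hw, t.2]; rfl⟩)
      (fun g t => Subtype.ext (Prod.ext (hom_smul x g t.1.1) rfl))
  refine (cls_eq_of_equiv (Equiv.ofBijective k ⟨?_, ?_⟩) (fun g t => hom_smul k g t)
    (fun _ => rfl)).symm
  · intro s t e
    have e1 : x s.1.1 = x t.1.1 := congrArg (fun r : fiberProd f (b ≫ y) => r.1.1) e
    have e2 : s.1.2 = t.1.2 := congrArg (fun r : fiberProd f (b ≫ y) => r.1.2) e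
    have e3 : f' s.1.1 = f' t.1.1 := s.2.trans ((congrArg b e2).trans t.2.symm)
    exact Subtype.ext (Prod.ext
      ((existsUnique_of_isPullback sq (f' t.1.1) (x t.1.1) (hw _)).unique ⟨e3, e1⟩ ⟨rfl, rfl⟩) e2)
  · rintro ⟨⟨t, r⟩, h⟩
    obtain ⟨c, ⟨h1, h2⟩, -⟩ := existsUnique_of_isPullback sq (b r) t h.symm
    exact ⟨⟨(c, r), h1⟩, Subtype.ext (Prod.ext h2 rfl)⟩

/-- For finite `G` there are only countably many isomorphism classes, so that they can be indexed
by a type in any universe. -/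
instance [Finite G] (X : FinGSet G) : Countable (IsoClass X) := by
  let I : Type u := Σ n : ℕ, (G → Fin n → Fin n) × (Fin n → X)
  have : Countable I := inferInstance
  let S : Set I := {i | ∃ (A : FinGSet G) (a : A ⟶ X) (e : A ≃ Fin i.1),
    (∀ g x, e (g • x) = i.2.1 g (e x)) ∧ ∀ x, a x = i.2.2 (e x)}
  choose A a e h1 h2 using fun i : S => i.2
  refine Function.Surjective.countable (f := fun i : S => cls (a i)) (fun c => ?_)
  induction c using cls_ind with | h B b
  obtain ⟨n, ⟨k⟩⟩ := Finite.exists_equiv_fin B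
  let i : S := ⟨⟨n, fun g x => k (g • k.symm x), fun x => b (k.symm x)⟩,
    B, b, k, fun g x => by simp, fun x => by simp⟩
  refine ⟨i, cls_eq_of_equiv ((e i).trans k.symm) (fun g x => ?_) (fun x => ?_)⟩
  · simp only [Equiv.trans_apply, h1 i]
    simp [i]
  · simp only [Equiv.trans_apply, h2 i]
    rfl

end Burnside

/-- The additive part `𝔄^α` of the Burnside semi-ring functor: `𝔄(X) = cl(Gs/X)` with disjoint
union as monoid operation, restriction by pull-back and transfer by composition. (`Shrink` only
replaces the countable set `cl(Gs/X)` by a copy of it in the universe of values.) -/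
noncomputable def burnsideAdd (G : Type u) [Group G] [Finite G] : SemiMackeyFunctor.{u, w} G where
  obj X := Shrink.{w} (Burnside.IsoClass X)
  monoid X := inferInstanceAs (CommMonoid (Shrink.{w} (Burnside.IsoClass X)))
  res {X Y} f := ((Shrink.mulEquiv.{w} (α := Burnside.IsoClass X)).symm.toMonoidHom.comp
    (Burnside.res f)).comp (Shrink.mulEquiv.{w} (α := Burnside.IsoClass Y)).toMonoidHom
  tr {X Y} f := ((Shrink.mulEquiv.{w} (α := Burnside.IsoClass Y)).symm.toMonoidHom.comp
    (Burnside.tr f)).comp (Shrink.mulEquiv.{w} (α := Burnside.IsoClass X)).toMonoidHom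
  res_id X m := by simp [Burnside.res_id]
  res_comp f h m := by simp [Burnside.res_comp]
  tr_id X m := by simp [Burnside.tr_id]
  tr_comp f h m := by simp [Burnside.tr_comp]
  additive_empty :=
    have := Burnside.subsingleton_empty (G := G)
    (equivShrink _).symm.subsingleton
  additive_sum X Y := by
    have h := Burnside.bijective_sum X Y
    have h' := ((Equiv.prodCongr (equivShrink.{w} _) (equivShrink.{w} _)).bijective.comp h).comp
      (equivShrink.{w} _).symm.bijective
    exact h'
  mackey sq m := by simp [Burnside.mackey sq]

/-! ### Tambara functors -/

/-- A Tambara functor on `G`. -/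
structure TambaraFunctor (G : Type u) [Group G] : Type (max (u + 1) (w + 1)) where
  obj : FinGSet G → Type w
  [ring : ∀ X, CommRing (obj X)]
  /-- restriction -/
  res : ∀ {X Y : FinGSet G}, (X ⟶ Y) → (obj Y →+* obj X)
  /-- additive transfer -/
  add : ∀ {X Y : FinGSet G}, (X ⟶ Y) → (obj X →+ obj Y)
  /-- multiplicative transfer -/
  mul : ∀ {X Y : FinGSet G}, (X ⟶ Y) → (obj X →* obj Y)
  res_id : ∀ (X : FinGSet G) (t : obj X), res (𝟙 X) t = t
  res_comp : ∀ {X Y Z : FinGSet G} (f : X ⟶ Y) (h : Y ⟶ Z) (t : obj Z),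
    res (f ≫ h) t = res f (res h t)
  add_id : ∀ (X : FinGSet G) (t : obj X), add (𝟙 X) t = t
  add_comp : ∀ {X Y Z : FinGSet G} (f : X ⟶ Y) (h : Y ⟶ Z) (t : obj X),
    add (f ≫ h) t = add h (add f t)
  mul_id : ∀ (X : FinGSet G) (t : obj X), mul (𝟙 X) t = t
  mul_comp : ∀ {X Y Z : FinGSet G} (f : X ⟶ Y) (h : Y ⟶ Z) (t : obj X),
    mul (f ≫ h) t = mul h (mul f t)
  additive_empty : Subsingleton (obj (FinGSet.empty G))
  additive_sum : ∀ X Y : FinGSet G, Function.Bijective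
    (fun t : obj (FinGSet.sum X Y) => (res (FinGSet.inl X Y) t, res (FinGSet.inr X Y) t))
  mackey_add : ∀ {X' Y' X Y : FinGSet G} {f' : X' ⟶ Y'} {x : X' ⟶ X} {y : Y' ⟶ Y} {f : X ⟶ Y},
    IsPullback f' x y f → ∀ t : obj Y', res f (add y t) = add x (res f' t)
  mackey_mul : ∀ {X' Y' X Y : FinGSet G} {f' : X' ⟶ Y'} {x : X' ⟶ X} {y : Y' ⟶ Y} {f : X ⟶ Y},
    IsPullback f' x y f → ∀ t : obj Y', res f (mul y t) = mul x (res f' t)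
  /-- the distributive law -/
  distrib : ∀ {A X Y Z B : FinGSet G} {f : X ⟶ Y} {p : A ⟶ X} {lam : Z ⟶ A} {rho : Z ⟶ B}
    {q : B ⟶ Y}, FinGSet.IsExponential f p lam rho q →
      ∀ t : obj A, mul f (add p t) = add q (mul rho (res lam t))

namespace TambaraFunctor

variable {G : Type u} [Group G]

attribute [instance] TambaraFunctor.ring

/-- A morphism of Tambara functors. -/
@[ext]
structure Hom (T S : TambaraFunctor.{u, w} G) : Type (max (u + 1) w) where
  app : ∀ X : FinGSet G, T.obj X →+* S.obj X
  app_res : ∀ {X Y : FinGSet G} (f : X ⟶ Y) (t : T.obj Y), app X (T.res f t) = S.res f (app Y t)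
  app_add : ∀ {X Y : FinGSet G} (f : X ⟶ Y) (t : T.obj X), app Y (T.add f t) = S.add f (app X t)
  app_mul : ∀ {X Y : FinGSet G} (f : X ⟶ Y) (t : T.obj X), app Y (T.mul f t) = S.mul f (app X t)

/-- The category `Tam_G`. The category of `T`-Tambara functors is `Under T`. -/
instance : Category (TambaraFunctor.{u, w} G) where
  Hom T S := Hom T S
  id T := ⟨fun X => RingHom.id (T.obj X), fun _ _ => rfl, fun _ _ => rfl, fun _ _ => rfl⟩
  comp φ ψ := ⟨fun X => (ψ.app X).comp (φ.app X),
    fun f t => by simp [φ.app_res, ψ.app_res], fun f t => by simp [φ.app_add, ψ.app_add],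
    fun f t => by simp [φ.app_mul, ψ.app_mul]⟩

/-- The multiplicative part `T ↦ T^μ`. -/
def multPart (G : Type u) [Group G] : TambaraFunctor.{u, w} G ⥤ SemiMackeyFunctor.{u, w} G where
  obj T :=
    { obj := T.obj
      res := fun f => (T.res f).toMonoidHom
      tr := fun f => T.mul f
      res_id := T.res_id
      res_comp := T.res_comp
      tr_id := T.mul_id
      tr_comp := T.mul_comp
      additive_empty := T.additive_empty
      additive_sum := T.additive_sum
      mackey := T.mackey_mul }
  map φ :=
    { app := fun X => (Hom.app φ X).toMonoidHom
      app_res := Hom.app_res φ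
      app_tr := Hom.app_mul φ }

/-- The functor `T ↦ T(X)` to commutative rings. -/
def evRing {G : Type u} [Group G] (X : FinGSet G) : TambaraFunctor.{u, w} G ⥤ CommRingCat.{w} where
  obj T := CommRingCat.of (T.obj X)
  map φ := CommRingCat.ofHom (Hom.app φ X)

/-- The functor `S ↦ S(G/G)` to sets. -/
def evPoint (G : Type u) [Group G] : TambaraFunctor.{u, w} G ⥤ Type w :=
  evRing (FinGSet.point G) ⋙ forget CommRingCat

/-- The functor `S ↦ S(G/e)^G` to sets. -/
def evFixedPoints (G : Type u) [Group G] [Finite G] : TambaraFunctor.{u, w} G ⥤ Type w :=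
  multPart G ⋙ SemiMackeyFunctor.evFixed G ⋙ forget CommMonCat

/-- The functor `𝓕(T, M) = T ⊗_Ω Ω[M]`: the coproduct in `Tam_G` of `T` and of the Tambarization
`Ω[M]` of `M`, the value at `M` of the left adjoint of `T ↦ T^μ`. -/
noncomputable def genDress (G : Type u) [Group G]
    [HasBinaryCoproducts (TambaraFunctor.{u, w} G)]
    [(multPart.{u, w} G).IsRightAdjoint] :
    TambaraFunctor.{u, w} G ⥤ SemiMackeyFunctor.{u, w} G ⥤ TambaraFunctor.{u, w} G :=
  coprod.functor ⋙ (Functor.whiskeringLeft _ _ _).obj (multPart.{u, w} G).leftAdjoint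

/-- The structure morphism `T ⟶ 𝓕(T, M)`, natural in `T`, making `𝓕(T, M)` a `T`-Tambara
functor. -/
noncomputable def genDressUnit (G : Type u) [Group G]
    [HasBinaryCoproducts (TambaraFunctor.{u, w} G)]
    [(multPart.{u, w} G).IsRightAdjoint] (M : SemiMackeyFunctor.{u, w} G) :
    𝟭 (TambaraFunctor.{u, w} G) ⟶ (genDress G).flip.obj M where
  app T := (coprod.inl : T ⟶ T ⨿ (multPart.{u, w} G).leftAdjoint.obj M)
  naturality _ _ τ := (coprod.inl_map τ (𝟙 ((multPart.{u, w} G).leftAdjoint.obj M))).symm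

/-- `𝓛^G_Q`, the value at the commutative monoid `Q` of the left adjoint of `M ↦ M(G/e)^G`, for
`Q = ℕ` the free commutative monoid on one generator. -/
noncomputable def freeFixedNat (G : Type u) [Group G] [Finite G]
    [(SemiMackeyFunctor.evFixed.{u, w} G).IsRightAdjoint] : SemiMackeyFunctor.{u, w} G :=
  (SemiMackeyFunctor.evFixed.{u, w} G).leftAdjoint.obj
    (CommMonCat.of (Multiplicative (ULift.{w} ℕ)))

/-- The functor `T ↦ T[X] = 𝓕(T, 𝔄^α)`. -/
noncomputable def polX (G : Type u) [Group G] [Finite G]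
    [HasBinaryCoproducts (TambaraFunctor.{u, w} G)]
    [(multPart.{u, w} G).IsRightAdjoint] : TambaraFunctor.{u, w} G ⥤ TambaraFunctor.{u, w} G :=
  (genDress G).flip.obj (burnsideAdd G)

/-- The structure morphism `T ⟶ T[X]`. -/
noncomputable def polXUnit (G : Type u) [Group G] [Finite G]
    [HasBinaryCoproducts (TambaraFunctor.{u, w} G)]
    [(multPart.{u, w} G).IsRightAdjoint] : 𝟭 (TambaraFunctor.{u, w} G) ⟶ polX G :=
  genDressUnit G (burnsideAdd G)

/-- The functor `T ↦ T[x] = 𝓕(T, 𝓛^G_ℕ)`. -/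
noncomputable def polx (G : Type u) [Group G] [Finite G]
    [HasBinaryCoproducts (TambaraFunctor.{u, w} G)]
    [(multPart.{u, w} G).IsRightAdjoint] [(SemiMackeyFunctor.evFixed.{u, w} G).IsRightAdjoint] :
    TambaraFunctor.{u, w} G ⥤ TambaraFunctor.{u, w} G :=
  (genDress G).flip.obj (freeFixedNat G)

/-- The structure morphism `T ⟶ T[x]`. -/
noncomputable def polxUnit (G : Type u) [Group G] [Finite G]
    [HasBinaryCoproducts (TambaraFunctor.{u, w} G)]
    [(multPart.{u, w} G).IsRightAdjoint] [(SemiMackeyFunctor.evFixed.{u, w} G).IsRightAdjoint] :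
    𝟭 (TambaraFunctor.{u, w} G) ⟶ polx G :=
  genDressUnit G (freeFixedNat G)

/-- For a functor `P` on `Tam_G` with a natural map `T ⟶ P(T)`, and a set-valued functor `E` on
`Tam_G`: bijections between the morphisms `P(T) ⟶ S` of `T`-Tambara functors and the elements of
`E(S)`, for all Tambara functors `T` and all `T`-Tambara functors `S`, natural in `S` and `T`. -/
structure NatBij (P : TambaraFunctor.{u, w} G ⥤ TambaraFunctor.{u, w} G)
    (η : 𝟭 (TambaraFunctor.{u, w} G) ⟶ P) (E : TambaraFunctor.{u, w} G ⥤ Type w) where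
  equiv : ∀ (T : TambaraFunctor.{u, w} G) (S : Under T),
    (Under.mk (Y := P.obj T) (η.app T) ⟶ S) ≃ E.obj S.right
  naturality_right : ∀ (T : TambaraFunctor.{u, w} G) (S S' : Under T) (ψ : S ⟶ S')
    (φ : Under.mk (Y := P.obj T) (η.app T) ⟶ S),
    equiv T S' (φ ≫ ψ) = E.map ψ.right (equiv T S φ)
  /-- For `τ : T ⟶ T'`, a `T'`-Tambara functor `(S, σ)` is regarded as the `T`-Tambara functor
  `(S, τ ≫ σ)`, and `φ : P(T') ⟶ S` is sent to `P(T) ⟶ P(T') ⟶ S`. -/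
  naturality_left : ∀ {T T' : TambaraFunctor.{u, w} G} (τ : T ⟶ T') (S : Under T')
    (φ : Under.mk (Y := P.obj T') (η.app T') ⟶ S),
    equiv T ((Under.map τ).obj S)
      (Under.homMk (P.map τ ≫ φ.right) (by
        have h₁ := η.naturality τ
        have h₂ := Under.w φ
        simp only [Functor.id_obj, Functor.id_map, Under.mk_hom] at h₁ h₂
        simp [← Category.assoc, ← h₁]
        simp [h₂])) = equiv T' S φ

/-- The element of `E(P(T))` that corresponds to the identity of `P(T)`. -/
def NatBij.generator {P : TambaraFunctor.{u, w} G ⥤ TambaraFunctor.{u, w} G}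
    {η : 𝟭 (TambaraFunctor.{u, w} G) ⟶ P} {E : TambaraFunctor.{u, w} G ⥤ Type w}
    (b : NatBij P η E) (T : TambaraFunctor.{u, w} G) : E.obj (P.obj T) :=
  b.equiv T (Under.mk (Y := P.obj T) (η.app T)) (𝟙 _)

end TambaraFunctor

/-- The functor `R ↦ R[X]` on commutative rings. -/
noncomputable def polynomialFunctor : CommRingCat.{w} ⥤ CommRingCat.{w} where
  obj R := CommRingCat.of (Polynomial R)
  map f := CommRingCat.ofHom (Polynomial.mapRingHom f.hom)
  map_id R := by ext <;> simp
  map_comp f g := by ext <;> simp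

/-! ### A small model of the category of finite `G`-sets -/

namespace FinGSet

variable {G : Type u} [Group G]

instance (X Y : FinGSet G) : Finite (X ⟶ Y) :=
  Finite.of_injective (fun f : X ⟶ Y => (f : X → Y)) DFunLike.coe_injective

instance [Finite G] : Countable (Skeleton (FinGSet G)) := by
  refine Function.Surjective.countable (α := Burnside.IsoClass (FinGSet.point G))
    (f := Quotient.map' (fun a => a.left) fun a b ⟨i⟩ => ⟨(Over.forget _).mapIso i⟩) ?_
  rintro ⟨X⟩
  exact ⟨Burnside.cls (A := X) (X := FinGSet.point G)
    (mkHom (Y := FinGSet.point G) (fun _ => PUnit.unit) fun _ _ => rfl), rfl⟩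

instance [Finite G] : EssentiallySmall.{w} (FinGSet G) :=
  (essentiallySmall_iff _).2 ⟨inferInstance, ⟨fun _ _ => inferInstance⟩⟩

/-- The object of the small model representing a finite `G`-set. -/
noncomputable abbrev toSmall [Finite G] : FinGSet G ⥤ SmallModel.{w} (FinGSet G) :=
  (equivSmallModel.{w} (FinGSet G)).functor

/-- The finite `G`-set represented by an object of the small model. -/
noncomputable abbrev ofSmall [Finite G] : SmallModel.{w} (FinGSet G) ⥤ FinGSet G :=
  (equivSmallModel.{w} (FinGSet G)).inverse

/-- The comparison of a finite `G`-set with its copy in the small model. -/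
noncomputable abbrev smallIso [Finite G] (X : FinGSet G) :
    X ≅ ofSmall.{u, w}.obj (toSmall.{u, w}.obj X) :=
  (equivSmallModel.{w} (FinGSet G)).unitIso.app X

theorem isPullback_smallIso [Finite G] {X Y : FinGSet G} (f : X ⟶ Y) :
    IsPullback (smallIso.{u, w} X).hom f (ofSmall.{u, w}.map (toSmall.{u, w}.map f))
      (smallIso.{u, w} Y).hom :=
  IsPullback.of_horiz_isIso
    ⟨((equivSmallModel.{w} (FinGSet G)).unitIso.hom.naturality f).symm⟩

theorem smallIso_comp [Finite G] {X Y : FinGSet G} (f : X ⟶ Y) :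
    (smallIso.{u, w} X).hom ≫ ofSmall.{u, w}.map (toSmall.{u, w}.map f) =
      f ≫ (smallIso.{u, w} Y).hom :=
  (isPullback_smallIso f).w

theorem ofSmall_counit [Finite G] (c : SmallModel.{w} (FinGSet G)) :
    (smallIso.{u, w} (ofSmall.{u, w}.obj c)).hom ≫
      ofSmall.map ((equivSmallModel.{w} (FinGSet G)).counitIso.hom.app c) = 𝟙 (ofSmall.obj c) :=
  (equivSmallModel.{w} (FinGSet G)).unit_inverse_comp c

/-- An injective map is its own kernel pair. -/
theorem isPullback_of_injective {X Y : FinGSet G} (f : X ⟶ Y) (hf : Function.Injective f) :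
    IsPullback (𝟙 X) (𝟙 X) f f :=
  have : Mono f := ⟨fun _ _ e => hom_ext fun x => hf (DFunLike.congr_fun e x)⟩
  IsKernelPair.id_of_mono f

/-- Two maps with disjoint images have empty pull-back. -/
theorem isPullback_of_disjoint {X Y Z : FinGSet G} (f : X ⟶ Y) (h : Z ⟶ Y)
    (hd : ∀ x z, f x ≠ h z) :
    IsPullback (Burnside.fromEmpty X) (Burnside.fromEmpty Z) f h where
  w := hom_ext fun x => PEmpty.elim x
  isLimit' := ⟨PullbackCone.IsLimit.mk _
    (fun s => mkHom (Y := FinGSet.empty G)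
      (fun x => (hd _ _ (DFunLike.congr_fun s.condition x)).elim)
      (fun _ x => (hd _ _ (DFunLike.congr_fun s.condition x)).elim))
    (fun s => hom_ext fun x => (hd _ _ (DFunLike.congr_fun s.condition x)).elim)
    (fun s => hom_ext fun x => (hd _ _ (DFunLike.congr_fun s.condition x)).elim)
    (fun s _ _ _ => hom_ext fun x => (hd _ _ (DFunLike.congr_fun s.condition x)).elim)⟩

end FinGSet

open FinGSet

/-! ### Transfers along injections -/

namespace SemiMackeyFunctor

variable {G : Type u} [Group G] (M : SemiMackeyFunctor.{u, w} G)

theorem res_tr_self {X Y : FinGSet G} (f : X ⟶ Y) (hf : Function.Injective f) (m : M.obj X) :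
    M.res f (M.tr f m) = m := by
  rw [M.mackey (isPullback_of_injective f hf), M.res_id, M.tr_id]

theorem res_tr_disjoint {X Y Z : FinGSet G} (f : X ⟶ Y) (h : Z ⟶ Y) (hd : ∀ x z, f x ≠ h z)
    (m : M.obj X) : M.res h (M.tr f m) = 1 := by
  have := M.additive_empty
  rw [M.mackey (isPullback_of_disjoint f h hd), Subsingleton.elim (M.res _ m) 1, map_one]

theorem res_inl_mul (X Y : FinGSet G) (a : M.obj X) (b : M.obj Y) :
    M.res (inl X Y) (M.tr (inl X Y) a * M.tr (inr X Y) b) = a := by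
  rw [map_mul, M.res_tr_self _ Sum.inl_injective, M.res_tr_disjoint, mul_one]
  intro x z e
  cases e

theorem res_inr_mul (X Y : FinGSet G) (a : M.obj X) (b : M.obj Y) :
    M.res (inr X Y) (M.tr (inl X Y) a * M.tr (inr X Y) b) = b := by
  rw [map_mul, M.res_tr_self _ Sum.inr_injective, M.res_tr_disjoint, one_mul]
  intro x z e
  cases e

theorem tr_inl_mul_tr_inr {X Y : FinGSet G} (m : M.obj (FinGSet.sum X Y)) :
    M.tr (inl X Y) (M.res (inl X Y) m) * M.tr (inr X Y) (M.res (inr X Y) m) = m :=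
  (M.additive_sum X Y).1 (Prod.ext (M.res_inl_mul ..) (M.res_inr_mul ..))

end SemiMackeyFunctor

namespace TambaraFunctor

variable {G : Type u} [Group G]

/-- The additive part `T ↦ T^α = (T^*, T_+)`, written multiplicatively. -/
def addPart (T : TambaraFunctor.{u, w} G) : SemiMackeyFunctor.{u, w} G where
  obj X := Multiplicative (T.obj X)
  res f := AddMonoidHom.toMultiplicative (T.res f).toAddMonoidHom
  tr f := AddMonoidHom.toMultiplicative (T.add f)
  res_id := T.res_id
  res_comp := T.res_comp
  tr_id := T.add_id
  tr_comp := T.add_comp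
  additive_empty := T.additive_empty
  additive_sum := T.additive_sum
  mackey := T.mackey_add

theorem res_inl_add (T : TambaraFunctor.{u, w} G) (X Y : FinGSet G) (a : T.obj X) (b : T.obj Y) :
    T.res (inl X Y) (T.add (inl X Y) a + T.add (inr X Y) b) = a :=
  T.addPart.res_inl_mul X Y a b

theorem res_inr_add (T : TambaraFunctor.{u, w} G) (X Y : FinGSet G) (a : T.obj X) (b : T.obj Y) :
    T.res (inr X Y) (T.add (inl X Y) a + T.add (inr X Y) b) = b :=
  T.addPart.res_inr_mul X Y a b

/-! ### Tambara functors generated by families of elements -/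

/-- Formal expressions in the operations of a Tambara functor. -/
inductive Term {C : Type w} [Category.{w} C] (gen : C → Type w) : C → Type w
  | of {c : C} (x : gen c) : Term gen c
  | zero (c : C) : Term gen c
  | one (c : C) : Term gen c
  | neg {c : C} (t : Term gen c) : Term gen c
  | plus {c : C} (s t : Term gen c) : Term gen c
  | times {c : C} (s t : Term gen c) : Term gen c
  | res {c d : C} (f : c ⟶ d) (t : Term gen d) : Term gen c
  | add {c d : C} (f : c ⟶ d) (t : Term gen c) : Term gen d
  | mul {c d : C} (f : c ⟶ d) (t : Term gen c) : Term gen d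

variable [Finite G] {gen : SmallModel.{w} (FinGSet G) → Type w}

/-- The value of a formal expression. -/
noncomputable def Term.eval (S : TambaraFunctor.{u, w} G) (v : ∀ c, gen c → S.obj (ofSmall.obj c)) :
    ∀ {c}, Term gen c → S.obj (ofSmall.obj c)
  | _, .of x => v _ x
  | _, .zero _ => 0
  | _, .one _ => 1
  | _, .neg t => -t.eval S v
  | _, .plus s t => s.eval S v + t.eval S v
  | _, .times s t => s.eval S v * t.eval S v
  | _, .res f t => S.res (ofSmall.map f) (t.eval S v)
  | _, .add f t => S.add (ofSmall.map f) (t.eval S v)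
  | _, .mul f t => S.mul (ofSmall.map f) (t.eval S v)

/-- The value of a formal expression, as an element at `X`. -/
noncomputable def Term.evalAt (S : TambaraFunctor.{u, w} G)
    (v : ∀ c, gen c → S.obj (ofSmall.obj c)) (X : FinGSet G)
    (t : Term gen (toSmall.{u, w}.obj X)) : S.obj X :=
  S.res (smallIso.{u, w} X).hom (t.eval S v)

section evalAt

variable (S : TambaraFunctor.{u, w} G) (v : ∀ c, gen c → S.obj (ofSmall.obj c)) {X Y : FinGSet G}

theorem Term.evalAt_res (f : X ⟶ Y) (t : Term gen (toSmall.{u, w}.obj Y)) :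
    (Term.res (toSmall.map f) t).evalAt S v X = S.res f (t.evalAt S v Y) := by
  simp only [Term.evalAt, Term.eval]
  rw [← S.res_comp, ← S.res_comp, smallIso_comp]

theorem Term.evalAt_add (f : X ⟶ Y) (t : Term gen (toSmall.{u, w}.obj X)) :
    (Term.add (toSmall.map f) t).evalAt S v Y = S.add f (t.evalAt S v X) :=
  S.mackey_add (isPullback_smallIso f) _

theorem Term.evalAt_mul (f : X ⟶ Y) (t : Term gen (toSmall.{u, w}.obj X)) :
    (Term.mul (toSmall.map f) t).evalAt S v Y = S.mul f (t.evalAt S v X) :=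
  S.mackey_mul (isPullback_smallIso f) _

end evalAt

variable {I : Type*} (R : I → TambaraFunctor.{u, w} G)
  (v : ∀ i c, gen c → (R i).obj (ofSmall.obj c))

/-- Two formal expressions are identified if they have the same value in all given models. -/
def termSetoid (X : FinGSet G) : Setoid (Term gen (toSmall.{u, w}.obj X)) where
  r s t := ∀ i, s.evalAt (R i) (v i) X = t.evalAt (R i) (v i) X
  iseqv := ⟨fun _ _ => rfl, fun h i => (h i).symm, fun h k i => (h i).trans (k i)⟩

/-- The values at `X` of the Tambara functor generated by formal expressions. -/
def TermClass (X : FinGSet G) : Type w := Quotient (termSetoid R v X)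

namespace TermClass

variable {R v} {X Y : FinGSet G}

/-- The value in a model. -/
noncomputable def ev (i : I) : TermClass R v X → (R i).obj X :=
  Quotient.lift (fun t => t.evalAt (R i) (v i) X) fun _ _ h => h i

theorem ext {a b : TermClass R v X} (h : ∀ i, a.ev i = b.ev i) : a = b := by
  induction a using Quotient.inductionOn
  induction b using Quotient.inductionOn
  exact Quotient.sound h

/-- A unary operation on formal expressions induces one on classes. -/
theorem sound_unary {f : Term gen (toSmall.{u, w}.obj X) → Term gen (toSmall.{u, w}.obj Y)}
    (g : ∀ i, (R i).obj X → (R i).obj Y)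
    (h : ∀ i t, (f t).evalAt (R i) (v i) Y = g i (t.evalAt (R i) (v i) X))
    (s t : Term gen (toSmall.{u, w}.obj X)) (e : termSetoid R v X s t) :
    termSetoid R v Y (f s) (f t) := fun i => by rw [h, h, e i]

noncomputable instance : Zero (TermClass R v X) := ⟨Quotient.mk _ (.zero _)⟩
noncomputable instance : One (TermClass R v X) := ⟨Quotient.mk _ (.one _)⟩
noncomputable instance : Neg (TermClass R v X) :=
  ⟨Quotient.map .neg (sound_unary (fun _ => Neg.neg) fun _ _ => map_neg ((R _).res _) _)⟩
noncomputable instance : Add (TermClass R v X) :=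
  ⟨Quotient.map₂ .plus fun a b h c d k i => by
    have e := congrArg₂ (· + ·) (h i) (k i)
    simpa only [Term.evalAt, Term.eval, map_add] using e⟩
noncomputable instance : Mul (TermClass R v X) :=
  ⟨Quotient.map₂ .times fun a b h c d k i => by
    have e := congrArg₂ (· * ·) (h i) (k i)
    simpa only [Term.evalAt, Term.eval, map_mul] using e⟩

variable (i : I)

theorem ev_zero : (0 : TermClass R v X).ev i = 0 := map_zero ((R i).res _)

theorem ev_one : (1 : TermClass R v X).ev i = 1 := map_one ((R i).res _)

theorem ev_neg (a : TermClass R v X) : (-a).ev i = -a.ev i := by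
  induction a using Quotient.inductionOn
  exact map_neg ((R i).res _) _

theorem ev_add (a b : TermClass R v X) : (a + b).ev i = a.ev i + b.ev i := by
  induction a using Quotient.inductionOn
  induction b using Quotient.inductionOn
  exact map_add ((R i).res _) _ _

theorem ev_mul (a b : TermClass R v X) : (a * b).ev i = a.ev i * b.ev i := by
  induction a using Quotient.inductionOn
  induction b using Quotient.inductionOn
  exact map_mul ((R i).res _) _ _

noncomputable instance : CommRing (TermClass R v X) :=
  CommRing.ofMinimalAxioms
    (fun a b c => ext fun i => by simp only [ev_add, add_assoc])
    (fun a => ext fun i => by simp only [ev_add, ev_zero, zero_add])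
    (fun a => ext fun i => by simp only [ev_add, ev_zero, ev_neg, neg_add_cancel])
    (fun a b c => ext fun i => by simp only [ev_mul, mul_assoc])
    (fun a b => ext fun i => by simp only [ev_mul, mul_comm])
    (fun a => ext fun i => by simp only [ev_mul, ev_one, one_mul])
    (fun a b c => ext fun i => by simp only [ev_mul, ev_add, mul_add])

/-- Restriction of classes. -/
noncomputable def res (f : X ⟶ Y) : TermClass R v Y →+* TermClass R v X :=
  have h := fun i => Term.evalAt_res (R i) (v i) f
  let r : TermClass R v Y → TermClass R v X :=
    Quotient.map (.res (toSmall.map f)) (sound_unary (fun i => (R i).res f) h)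
  have hr : ∀ i a, (r a).ev i = (R i).res f (a.ev i) := fun i a => Quotient.inductionOn a (h i)
  { toFun := r
    map_one' := ext fun i => by simp only [hr, ev_one, map_one]
    map_zero' := ext fun i => by simp only [hr, ev_zero, map_zero]
    map_mul' := fun a b => ext fun i => by simp only [hr, ev_mul, map_mul]
    map_add' := fun a b => ext fun i => by simp only [hr, ev_add, map_add] }

/-- Additive transfer of classes. -/
noncomputable def tradd (f : X ⟶ Y) : TermClass R v X →+ TermClass R v Y :=
  have h := fun i => Term.evalAt_add (R i) (v i) f
  let r : TermClass R v X → TermClass R v Y :=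
    Quotient.map (.add (toSmall.map f)) (sound_unary (fun i => (R i).add f) h)
  have hr : ∀ i a, (r a).ev i = (R i).add f (a.ev i) := fun i a => Quotient.inductionOn a (h i)
  { toFun := r
    map_zero' := ext fun i => by simp only [hr, ev_zero, map_zero]
    map_add' := fun a b => ext fun i => by simp only [hr, ev_add, map_add] }

/-- Multiplicative transfer of classes. -/
noncomputable def trmul (f : X ⟶ Y) : TermClass R v X →* TermClass R v Y :=
  have h := fun i => Term.evalAt_mul (R i) (v i) f
  let r : TermClass R v X → TermClass R v Y :=
    Quotient.map (.mul (toSmall.map f)) (sound_unary (fun i => (R i).mul f) h)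
  have hr : ∀ i a, (r a).ev i = (R i).mul f (a.ev i) := fun i a => Quotient.inductionOn a (h i)
  { toFun := r
    map_one' := ext fun i => by simp only [hr, ev_one, map_one]
    map_mul' := fun a b => ext fun i => by simp only [hr, ev_mul, map_mul] }

theorem ev_res (f : X ⟶ Y) (a : TermClass R v Y) : (res f a).ev i = (R i).res f (a.ev i) := by
  induction a using Quotient.inductionOn
  exact Term.evalAt_res (R i) (v i) f _

theorem ev_tradd (f : X ⟶ Y) (a : TermClass R v X) : (tradd f a).ev i = (R i).add f (a.ev i) := by
  induction a using Quotient.inductionOn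
  exact Term.evalAt_add (R i) (v i) f _

theorem ev_trmul (f : X ⟶ Y) (a : TermClass R v X) : (trmul f a).ev i = (R i).mul f (a.ev i) := by
  induction a using Quotient.inductionOn
  exact Term.evalAt_mul (R i) (v i) f _

end TermClass

open TermClass in
/-- The Tambara functor of formal expressions, modulo the equations that hold in given models. -/
noncomputable def termModel : TambaraFunctor.{u, w} G where
  obj X := TermClass R v X
  res f := TermClass.res f
  add f := TermClass.tradd f
  mul f := TermClass.trmul f
  res_id X t := ext fun i => by simpa only [ev_res] using (R i).res_id X _
  res_comp f h t := ext fun i => by simpa only [ev_res] using (R i).res_comp f h _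
  add_id X t := ext fun i => by simpa only [ev_tradd] using (R i).add_id X _
  add_comp f h t := ext fun i => by simpa only [ev_tradd] using (R i).add_comp f h _
  mul_id X t := ext fun i => by simpa only [ev_trmul] using (R i).mul_id X _
  mul_comp f h t := ext fun i => by simpa only [ev_trmul] using (R i).mul_comp f h _
  additive_empty := ⟨fun a b => ext fun i => (R i).additive_empty.elim _ _⟩
  additive_sum X Y := by
    refine ⟨fun a b e => ext fun i => ((R i).additive_sum X Y).1 ?_, fun ⟨a, b⟩ =>
      ⟨tradd (inl X Y) a + tradd (inr X Y) b, Prod.ext ?_ ?_⟩⟩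
    · have h1 := congrArg (TermClass.ev i) (Prod.ext_iff.1 e).1
      have h2 := congrArg (TermClass.ev i) (Prod.ext_iff.1 e).2
      exact Prod.ext ((ev_res ..).symm.trans (h1.trans (ev_res ..)))
        ((ev_res ..).symm.trans (h2.trans (ev_res ..)))
    · refine TermClass.ext (a := TermClass.res _ _) fun i => ?_
      simpa only [ev_res, ev_tradd, ev_add] using (R i).res_inl_add X Y _ _
    · refine TermClass.ext (a := TermClass.res _ _) fun i => ?_
      simpa only [ev_res, ev_tradd, ev_add] using (R i).res_inr_add X Y _ _
  mackey_add sq t := ext fun i => by simpa only [ev_res, ev_tradd] using (R i).mackey_add sq _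
  mackey_mul sq t := ext fun i => by simpa only [ev_res, ev_trmul] using (R i).mackey_mul sq _
  distrib h t := ext fun i => by
    simpa only [ev_res, ev_tradd, ev_trmul] using (R i).distrib h _

/-- Evaluation of formal expressions in a model. -/
noncomputable def termEval (i : I) : termModel R v ⟶ R i where
  app _ :=
    { toFun := TermClass.ev i
      map_one' := TermClass.ev_one i
      map_zero' := TermClass.ev_zero i
      map_mul' := TermClass.ev_mul i
      map_add' := TermClass.ev_add i }
  app_res := TermClass.ev_res i
  app_add := TermClass.ev_tradd i
  app_mul := TermClass.ev_trmul i

theorem termModel_ext {X : FinGSet G} {a b : (termModel R v).obj X}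
    (h : ∀ i, (termEval R v i).app X a = (termEval R v i).app X b) : a = b :=
  TermClass.ext h

/-- The element given by a formal expression. -/
noncomputable def termMk {c : SmallModel.{w} (FinGSet G)} (t : Term gen c) :
    (termModel R v).obj (ofSmall.obj c) :=
  Quotient.mk (termSetoid R v _) (.res ((equivSmallModel.{w} (FinGSet G)).counitIso.hom.app c) t)

theorem termEval_termMk (i : I) {c : SmallModel.{w} (FinGSet G)} (t : Term gen c) :
    (termEval R v i).app _ (termMk R v t) = t.eval (R i) (v i) := by
  change (R i).res _ ((R i).res _ _) = _
  rw [← (R i).res_comp, ofSmall_counit, (R i).res_id]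

/-- The element given by a generator. -/
noncomputable def termOf {c : SmallModel.{w} (FinGSet G)} (x : gen c) :
    (termModel R v).obj (ofSmall.obj c) := termMk R v (.of x)

theorem termEval_termOf (i : I) {c : SmallModel.{w} (FinGSet G)} (x : gen c) :
    (termEval R v i).app _ (termOf R v x) = v i c x := termEval_termMk R v i _

/-- Morphisms out of `termModel` are determined by their values on generators. -/
theorem termModel_hom_ext {S : TambaraFunctor.{u, w} G} {φ ψ : termModel R v ⟶ S}
    (h : ∀ (c : SmallModel.{w} (FinGSet G)) (x : gen c),
      φ.app _ (termOf R v x) = ψ.app _ (termOf R v x)) : φ = ψ := by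
  have key : ∀ {c : SmallModel.{w} (FinGSet G)} (t : Term gen c),
      φ.app _ (termMk R v t) = ψ.app _ (termMk R v t) := by
    intro c t
    induction t with
    | of x => exact h _ x
    | zero c =>
      have e : termMk R v (.zero c) = 0 := termModel_ext R v fun i => by
        rw [termEval_termMk, map_zero, Term.eval]
      rw [e, map_zero, map_zero]
    | one c =>
      have e : termMk R v (.one c) = 1 := termModel_ext R v fun i => by
        rw [termEval_termMk, map_one, Term.eval]
      rw [e, map_one, map_one]
    | neg t ih =>
      have e : termMk R v t.neg = -termMk R v t := termModel_ext R v fun i => by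
        rw [map_neg, termEval_termMk, termEval_termMk, Term.eval]
      rw [e, map_neg, map_neg, ih]
    | plus s t ihs iht =>
      have e : termMk R v (s.plus t) = termMk R v s + termMk R v t := termModel_ext R v fun i => by
        rw [map_add, termEval_termMk, termEval_termMk, termEval_termMk, Term.eval]
      rw [e, map_add, map_add, ihs, iht]
    | times s t ihs iht =>
      have e : termMk R v (s.times t) = termMk R v s * termMk R v t := termModel_ext R v fun i => by
        rw [map_mul, termEval_termMk, termEval_termMk, termEval_termMk, Term.eval]
      rw [e, map_mul, map_mul, ihs, iht]
    | res f t ih =>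
      have e : termMk R v (t.res f) = (termModel R v).res (ofSmall.map f) (termMk R v t) :=
        termModel_ext R v fun i => by
          rw [Hom.app_res, termEval_termMk, termEval_termMk, Term.eval]
      rw [e, Hom.app_res, Hom.app_res, ih]
    | add f t ih =>
      have e : termMk R v (t.add f) = (termModel R v).add (ofSmall.map f) (termMk R v t) :=
        termModel_ext R v fun i => by
          rw [Hom.app_add, termEval_termMk, termEval_termMk, Term.eval]
      rw [e, Hom.app_add, Hom.app_add, ih]
    | mul f t ih =>
      have e : termMk R v (t.mul f) = (termModel R v).mul (ofSmall.map f) (termMk R v t) :=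
        termModel_ext R v fun i => by
          rw [Hom.app_mul, termEval_termMk, termEval_termMk, Term.eval]
      rw [e, Hom.app_mul, Hom.app_mul, ih]
  refine Hom.ext (funext fun X => RingHom.ext fun a => ?_)
  obtain ⟨t, rfl⟩ := Quotient.exists_rep a
  have e : Quotient.mk (termSetoid R v X) t =
      (termModel R v).res (smallIso X).hom (termMk R v t) := termModel_ext R v fun i => by
    rw [Hom.app_res, termEval_termMk]
    rfl
  rw [e, Hom.app_res, Hom.app_res, key]

end TambaraFunctor

namespace TambaraFunctor

variable {G : Type u} [Group G]

theorem hom_ext {T S : TambaraFunctor.{u, w} G} {φ ψ : T ⟶ S}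
    (h : ∀ X t, φ.app X t = ψ.app X t) : φ = ψ :=
  Hom.ext (funext fun X => RingHom.ext (h X))

variable [Finite G] {gen : SmallModel.{w} (FinGSet G) → Type w}

section

variable {I : Type*} (R : I → TambaraFunctor.{u, w} G)
  (v : ∀ i c, gen c → (R i).obj (ofSmall.obj c))

/-- A family of elements that specializes to morphisms in all models is a morphism. -/
noncomputable def termLift {T : TambaraFunctor.{u, w} G} (φ : ∀ i, T ⟶ R i)
    (ι : ∀ X, T.obj X → (termModel R v).obj X)
    (h : ∀ i X t, (termEval R v i).app X (ι X t) = (φ i).app X t) : T ⟶ termModel R v where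
  app X :=
    { toFun := ι X
      map_one' := termModel_ext R v fun i => by rw [h, map_one, map_one]
      map_zero' := termModel_ext R v fun i => by rw [h, map_zero, map_zero]
      map_mul' := fun a b => termModel_ext R v fun i => by rw [h, map_mul, map_mul, h, h]
      map_add' := fun a b => termModel_ext R v fun i => by rw [h, map_add, map_add, h, h] }
  app_res f t := termModel_ext R v fun i => by
    refine (h ..).trans (((φ i).app_res f t).trans ?_)
    rw [(termEval R v i).app_res]
    exact congrArg _ (h ..).symm
  app_add f t := termModel_ext R v fun i => by
    refine (h ..).trans (((φ i).app_add f t).trans ?_)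
    rw [(termEval R v i).app_add]
    exact congrArg _ (h ..).symm
  app_mul f t := termModel_ext R v fun i => by
    refine (h ..).trans (((φ i).app_mul f t).trans ?_)
    rw [(termEval R v i).app_mul]
    exact congrArg _ (h ..).symm

/-- A family of elements that specializes to multiplicative morphisms in all models is a
multiplicative morphism. -/
noncomputable def termLiftMult {M : SemiMackeyFunctor.{u, w} G} (φ : ∀ i, M ⟶ (multPart G).obj (R i))
    (ι : ∀ X, M.obj X → (termModel R v).obj X)
    (h : ∀ i X t, (termEval R v i).app X (ι X t) = (φ i).app X t) :
    M ⟶ (multPart G).obj (termModel R v) where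
  app X :=
    { toFun := ι X
      map_one' := termModel_ext R v fun i => (h ..).trans ((map_one _).trans (map_one _).symm)
      map_mul' := fun a b => termModel_ext R v fun i => by
        refine (h ..).trans ((map_mul _ _ _).trans (.trans ?_ (map_mul _ _ _).symm))
        exact congrArg₂ _ (h ..).symm (h ..).symm }
  app_res f t := termModel_ext R v fun i => by
    refine (h ..).trans (((φ i).app_res f t).trans (.trans ?_ ((termEval R v i).app_res f _).symm))
    exact congrArg ((R i).res f) (h ..).symm
  app_tr f t := termModel_ext R v fun i => by
    refine (h ..).trans (((φ i).app_tr f t).trans (.trans ?_ ((termEval R v i).app_mul f _).symm))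
    exact congrArg ((R i).mul f) (h ..).symm

end

section coproduct

variable (T S : TambaraFunctor.{u, w} G)

/-- The models of a coproduct: pairs of morphisms with the same target. -/
abbrev CoprodModels := Σ R : TambaraFunctor.{u, w} G, (T ⟶ R) × (S ⟶ R)

/-- The values of the generators of the coproduct in a model. -/
noncomputable def coprodVal (i : CoprodModels T S) (c : SmallModel.{w} (FinGSet G)) :
    T.obj (ofSmall.obj c) ⊕ S.obj (ofSmall.obj c) → i.1.obj (ofSmall.obj c) :=
  Sum.elim (i.2.1.app _) (i.2.2.app _)

/-- The coproduct of two Tambara functors. -/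
noncomputable def coprodObj : TambaraFunctor.{u, w} G :=
  termModel (fun i : CoprodModels T S => i.1) (coprodVal T S)

theorem termEval_res_termOf_inl (i : CoprodModels T S) (X : FinGSet G) (t : T.obj X) :
    (termEval (fun i : CoprodModels T S => i.1) (coprodVal T S) i).app X ((coprodObj T S).res
      (smallIso X).hom (termOf _ (coprodVal T S) (Sum.inl (T.res (smallIso X).inv t)))) =
      i.2.1.app X t := by
  refine ((termEval _ _ i).app_res _ _).trans ?_
  rw [termEval_termOf]
  refine (i.2.1.app_res (smallIso X).hom _).symm.trans ?_
  rw [← T.res_comp, Iso.hom_inv_id, T.res_id]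

/-- The first inclusion into the coproduct. -/
noncomputable def coprodInl : T ⟶ coprodObj T S :=
  termLift _ _ (fun i => i.2.1) _ (termEval_res_termOf_inl T S)

theorem coprodInl_eval (i : CoprodModels T S) :
    coprodInl T S ≫ termEval (fun i : CoprodModels T S => i.1) (coprodVal T S) i = i.2.1 :=
  hom_ext (termEval_res_termOf_inl T S i)

theorem termEval_res_termOf_inr (i : CoprodModels T S) (X : FinGSet G) (t : S.obj X) :
    (termEval (fun i : CoprodModels T S => i.1) (coprodVal T S) i).app X ((coprodObj T S).res
      (smallIso X).hom (termOf _ (coprodVal T S) (Sum.inr (S.res (smallIso X).inv t)))) =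
      i.2.2.app X t := by
  refine ((termEval _ _ i).app_res _ _).trans ?_
  rw [termEval_termOf]
  refine (i.2.2.app_res (smallIso X).hom _).symm.trans ?_
  rw [← S.res_comp, Iso.hom_inv_id, S.res_id]

/-- The second inclusion into the coproduct. -/
noncomputable def coprodInr : S ⟶ coprodObj T S :=
  termLift _ _ (fun i => i.2.2) _ (termEval_res_termOf_inr T S)

theorem coprodInr_eval (i : CoprodModels T S) :
    coprodInr T S ≫ termEval (fun i : CoprodModels T S => i.1) (coprodVal T S) i = i.2.2 :=
  hom_ext (termEval_res_termOf_inr T S i)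

variable {T S}

theorem coprodObj_hom_ext {R : TambaraFunctor.{u, w} G} {φ ψ : coprodObj T S ⟶ R}
    (hl : coprodInl T S ≫ φ = coprodInl T S ≫ ψ) (hr : coprodInr T S ≫ φ = coprodInr T S ≫ ψ) :
    φ = ψ := by
  refine termModel_hom_ext _ _ fun c x => ?_
  rcases x with x | x
  · have e : termOf _ (coprodVal T S) (Sum.inl x) = (coprodInl T S).app _ x :=
      termModel_ext _ _ fun i => by
        rw [termEval_termOf]
        exact (termEval_res_termOf_inl T S i _ x).symm
    rw [e]
    exact DFunLike.congr_fun (congrFun (congrArg Hom.app hl) _) x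
  · have e : termOf _ (coprodVal T S) (Sum.inr x) = (coprodInr T S).app _ x :=
      termModel_ext _ _ fun i => by
        rw [termEval_termOf]
        exact (termEval_res_termOf_inr T S i _ x).symm
    rw [e]
    exact DFunLike.congr_fun (congrFun (congrArg Hom.app hr) _) x

variable (G) in
theorem hasBinaryCoproducts : HasBinaryCoproducts (TambaraFunctor.{u, w} G) :=
  have (T S : TambaraFunctor.{u, w} G) : HasColimit (pair T S) :=
    ⟨⟨⟨BinaryCofan.mk (coprodInl T S) (coprodInr T S),
      BinaryCofan.IsColimit.mk _ (fun {R} f g => termEval _ _ (⟨R, f, g⟩ : CoprodModels T S))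
        (fun f g => coprodInl_eval T S ⟨_, f, g⟩) (fun f g => coprodInr_eval T S ⟨_, f, g⟩)
        (fun f g _ hf hg => coprodObj_hom_ext
          (hf.trans (coprodInl_eval T S ⟨_, f, g⟩).symm)
          (hg.trans (coprodInr_eval T S ⟨_, f, g⟩).symm))⟩⟩⟩
  hasBinaryCoproducts_of_hasColimit_pair _

end coproduct

section tambarization

variable (M : SemiMackeyFunctor.{u, w} G)

/-- The models of the Tambarization: multiplicative morphisms to Tambara functors. -/
abbrev MultModels := Σ R : TambaraFunctor.{u, w} G, (M ⟶ (multPart G).obj R)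

/-- The values of the generators of the Tambarization in a model. -/
noncomputable def multVal (i : MultModels M) (c : SmallModel.{w} (FinGSet G)) :
    M.obj (ofSmall.obj c) → i.1.obj (ofSmall.obj c) :=
  i.2.app _

/-- The Tambarization of a semi-Mackey functor. -/
noncomputable def tambarization : TambaraFunctor.{u, w} G :=
  termModel (fun i : MultModels M => i.1) (multVal M)

theorem termEval_res_termOf (i : MultModels M) (X : FinGSet G) (m : M.obj X) :
    (termEval (fun i : MultModels M => i.1) (multVal M) i).app X ((tambarization M).res
      (smallIso X).hom (termOf _ (multVal M) (M.res (smallIso X).inv m))) = i.2.app X m := by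
  refine ((termEval _ _ i).app_res _ _).trans ?_
  rw [termEval_termOf]
  refine (i.2.app_res (smallIso X).hom _).symm.trans ?_
  rw [← M.res_comp, Iso.hom_inv_id, M.res_id]

/-- The unit of the Tambarization. -/
noncomputable def tambarizationUnit : M ⟶ (multPart G).obj (tambarization M) :=
  termLiftMult _ _ (fun i => i.2) _ (termEval_res_termOf M)

theorem tambarizationUnit_eval (i : MultModels M) :
    tambarizationUnit M ≫ (multPart G).map (termEval _ _ i) = i.2 :=
  SemiMackeyFunctor.Hom.ext (funext fun X => MonoidHom.ext (termEval_res_termOf M i X))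

variable {M}

theorem tambarization_hom_ext {R : TambaraFunctor.{u, w} G} {φ ψ : tambarization M ⟶ R}
    (h : tambarizationUnit M ≫ (multPart G).map φ = tambarizationUnit M ≫ (multPart G).map ψ) :
    φ = ψ := by
  refine termModel_hom_ext _ _ fun c x => ?_
  have e : termOf _ (multVal M) x = (tambarizationUnit M).app _ x :=
    termModel_ext _ _ fun i => by
      rw [termEval_termOf]
      exact (termEval_res_termOf M i _ x).symm
  rw [e]
  exact DFunLike.congr_fun (congrFun (congrArg SemiMackeyFunctor.Hom.app h) _) x

variable (G) in
theorem isRightAdjoint_multPart : (multPart.{u, w} G).IsRightAdjoint :=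
  (Adjunction.adjunctionOfEquivLeft (G := multPart.{u, w} G)
    (F_obj := tambarization)
    (fun M R =>
      { toFun := fun φ => tambarizationUnit M ≫ (multPart G).map φ
        invFun := fun ψ => termEval _ _ (⟨R, ψ⟩ : MultModels M)
        left_inv := fun φ => tambarization_hom_ext
          (tambarizationUnit_eval M ⟨R, tambarizationUnit M ≫ (multPart G).map φ⟩)
        right_inv := fun ψ => tambarizationUnit_eval M ⟨R, ψ⟩ })
    (fun _ _ _ _ _ => rfl)).isRightAdjoint

end tambarization

end TambaraFunctor

namespace SemiMackeyFunctor

variable {G : Type u} [Group G]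

theorem hom_ext {M N : SemiMackeyFunctor.{u, w} G} {φ ψ : M ⟶ N}
    (h : ∀ X m, φ.app X m = ψ.app X m) : φ = ψ :=
  Hom.ext (funext fun X => MonoidHom.ext (h X))

/-! ### Semi-Mackey functors generated by families of elements -/

/-- Formal expressions in the operations of a semi-Mackey functor. -/
inductive Term {C : Type w} [Category.{w} C] (gen : C → Type w) : C → Type w
  | of {c : C} (x : gen c) : Term gen c
  | one (c : C) : Term gen c
  | times {c : C} (s t : Term gen c) : Term gen c
  | res {c d : C} (f : c ⟶ d) (t : Term gen d) : Term gen c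
  | tr {c d : C} (f : c ⟶ d) (t : Term gen c) : Term gen d

variable [Finite G] {gen : SmallModel.{w} (FinGSet G) → Type w}

/-- The value of a formal expression. -/
noncomputable def Term.eval (M : SemiMackeyFunctor.{u, w} G)
    (v : ∀ c, gen c → M.obj (ofSmall.obj c)) : ∀ {c}, Term gen c → M.obj (ofSmall.obj c)
  | _, .of x => v _ x
  | _, .one _ => 1
  | _, .times s t => s.eval M v * t.eval M v
  | _, .res f t => M.res (ofSmall.map f) (t.eval M v)
  | _, .tr f t => M.tr (ofSmall.map f) (t.eval M v)

/-- The value of a formal expression, as an element at `X`. -/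
noncomputable def Term.evalAt (M : SemiMackeyFunctor.{u, w} G)
    (v : ∀ c, gen c → M.obj (ofSmall.obj c)) (X : FinGSet G)
    (t : Term gen (toSmall.{u, w}.obj X)) : M.obj X :=
  M.res (smallIso.{u, w} X).hom (t.eval M v)

section evalAt

variable (M : SemiMackeyFunctor.{u, w} G) (v : ∀ c, gen c → M.obj (ofSmall.obj c)) {X Y : FinGSet G}

theorem Term.evalAt_res (f : X ⟶ Y) (t : Term gen (toSmall.{u, w}.obj Y)) :
    (Term.res (toSmall.map f) t).evalAt M v X = M.res f (t.evalAt M v Y) := by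
  simp only [Term.evalAt, Term.eval]
  rw [← M.res_comp, ← M.res_comp, smallIso_comp]

theorem Term.evalAt_tr (f : X ⟶ Y) (t : Term gen (toSmall.{u, w}.obj X)) :
    (Term.tr (toSmall.map f) t).evalAt M v Y = M.tr f (t.evalAt M v X) :=
  M.mackey (isPullback_smallIso f) _

end evalAt

variable {I : Type*} (R : I → SemiMackeyFunctor.{u, w} G)
  (v : ∀ i c, gen c → (R i).obj (ofSmall.obj c))

/-- Two formal expressions are identified if they have the same value in all given models. -/
def termSetoid (X : FinGSet G) : Setoid (Term gen (toSmall.{u, w}.obj X)) where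
  r s t := ∀ i, s.evalAt (R i) (v i) X = t.evalAt (R i) (v i) X
  iseqv := ⟨fun _ _ => rfl, fun h i => (h i).symm, fun h k i => (h i).trans (k i)⟩

/-- The values at `X` of the semi-Mackey functor generated by formal expressions. -/
def TermClass (X : FinGSet G) : Type w := Quotient (termSetoid R v X)

namespace TermClass

variable {R v} {X Y : FinGSet G}

/-- The value in a model. -/
noncomputable def ev (i : I) : TermClass R v X → (R i).obj X :=
  Quotient.lift (fun t => t.evalAt (R i) (v i) X) fun _ _ h => h i

theorem ext {a b : TermClass R v X} (h : ∀ i, a.ev i = b.ev i) : a = b := by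
  induction a using Quotient.inductionOn
  induction b using Quotient.inductionOn
  exact Quotient.sound h

noncomputable instance : One (TermClass R v X) := ⟨Quotient.mk _ (.one _)⟩
noncomputable instance : Mul (TermClass R v X) :=
  ⟨Quotient.map₂ .times fun a b h c d k i => by
    have e := congrArg₂ (· * ·) (h i) (k i)
    simpa only [Term.evalAt, Term.eval, map_mul] using e⟩

variable (i : I)

theorem ev_one : (1 : TermClass R v X).ev i = 1 := map_one ((R i).res _)

theorem ev_mul (a b : TermClass R v X) : (a * b).ev i = a.ev i * b.ev i := by
  induction a using Quotient.inductionOn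
  induction b using Quotient.inductionOn
  exact map_mul ((R i).res _) _ _

noncomputable instance : CommMonoid (TermClass R v X) where
  mul_assoc a b c := ext fun i => by simp only [ev_mul, mul_assoc]
  mul_comm a b := ext fun i => by simp only [ev_mul, mul_comm]
  one_mul a := ext fun i => by simp only [ev_mul, ev_one, one_mul]
  mul_one a := ext fun i => by simp only [ev_mul, ev_one, mul_one]

/-- Restriction of classes. -/
noncomputable def res (f : X ⟶ Y) : TermClass R v Y →* TermClass R v X :=
  have h := fun i => Term.evalAt_res (R i) (v i) f
  let r : TermClass R v Y → TermClass R v X :=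
    Quotient.map (.res (toSmall.map f)) fun s t e i => by rw [h, h, e i]
  have hr : ∀ i a, (r a).ev i = (R i).res f (a.ev i) := fun i a => Quotient.inductionOn a (h i)
  { toFun := r
    map_one' := ext fun i => by simp only [hr, ev_one, map_one]
    map_mul' := fun a b => ext fun i => by simp only [hr, ev_mul, map_mul] }

/-- Transfer of classes. -/
noncomputable def tr (f : X ⟶ Y) : TermClass R v X →* TermClass R v Y :=
  have h := fun i => Term.evalAt_tr (R i) (v i) f
  let r : TermClass R v X → TermClass R v Y :=
    Quotient.map (.tr (toSmall.map f)) fun s t e i => by rw [h, h, e i]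
  have hr : ∀ i a, (r a).ev i = (R i).tr f (a.ev i) := fun i a => Quotient.inductionOn a (h i)
  { toFun := r
    map_one' := ext fun i => by simp only [hr, ev_one, map_one]
    map_mul' := fun a b => ext fun i => by simp only [hr, ev_mul, map_mul] }

theorem ev_res (f : X ⟶ Y) (a : TermClass R v Y) : (res f a).ev i = (R i).res f (a.ev i) := by
  induction a using Quotient.inductionOn
  exact Term.evalAt_res (R i) (v i) f _

theorem ev_tr (f : X ⟶ Y) (a : TermClass R v X) : (tr f a).ev i = (R i).tr f (a.ev i) := by
  induction a using Quotient.inductionOn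
  exact Term.evalAt_tr (R i) (v i) f _

end TermClass

open TermClass in
/-- The semi-Mackey functor of formal expressions, modulo the equations that hold in given
models. -/
noncomputable def termModel : SemiMackeyFunctor.{u, w} G where
  obj X := TermClass R v X
  res f := TermClass.res f
  tr f := TermClass.tr f
  res_id X t := ext fun i => by simpa only [ev_res] using (R i).res_id X _
  res_comp f h t := ext fun i => by simpa only [ev_res] using (R i).res_comp f h _
  tr_id X t := ext fun i => by simpa only [ev_tr] using (R i).tr_id X _
  tr_comp f h t := ext fun i => by simpa only [ev_tr] using (R i).tr_comp f h _
  additive_empty := ⟨fun a b => ext fun i => (R i).additive_empty.elim _ _⟩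
  additive_sum X Y := by
    refine ⟨fun a b e => ext fun i => ((R i).additive_sum X Y).1 ?_, fun ⟨a, b⟩ =>
      ⟨TermClass.tr (inl X Y) a * TermClass.tr (inr X Y) b, Prod.ext ?_ ?_⟩⟩
    · have h1 := congrArg (TermClass.ev i) (Prod.ext_iff.1 e).1
      have h2 := congrArg (TermClass.ev i) (Prod.ext_iff.1 e).2
      exact Prod.ext ((ev_res ..).symm.trans (h1.trans (ev_res ..)))
        ((ev_res ..).symm.trans (h2.trans (ev_res ..)))
    · refine TermClass.ext (a := TermClass.res _ _) fun i => ?_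
      simpa only [ev_res, ev_tr, ev_mul] using (R i).res_inl_mul X Y _ _
    · refine TermClass.ext (a := TermClass.res _ _) fun i => ?_
      simpa only [ev_res, ev_tr, ev_mul] using (R i).res_inr_mul X Y _ _
  mackey sq t := ext fun i => by simpa only [ev_res, ev_tr] using (R i).mackey sq _

/-- Evaluation of formal expressions in a model. -/
noncomputable def termEval (i : I) : termModel R v ⟶ R i where
  app _ :=
    { toFun := TermClass.ev i
      map_one' := TermClass.ev_one i
      map_mul' := TermClass.ev_mul i }
  app_res := TermClass.ev_res i
  app_tr := TermClass.ev_tr i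

theorem termModel_ext {X : FinGSet G} {a b : (termModel R v).obj X}
    (h : ∀ i, (termEval R v i).app X a = (termEval R v i).app X b) : a = b :=
  TermClass.ext h

/-- The element given by a formal expression. -/
noncomputable def termMk {c : SmallModel.{w} (FinGSet G)} (t : Term gen c) :
    (termModel R v).obj (ofSmall.obj c) :=
  Quotient.mk (termSetoid R v _) (.res ((equivSmallModel.{w} (FinGSet G)).counitIso.hom.app c) t)

theorem termEval_termMk (i : I) {c : SmallModel.{w} (FinGSet G)} (t : Term gen c) :
    (termEval R v i).app _ (termMk R v t) = t.eval (R i) (v i) := by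
  change (R i).res _ ((R i).res _ _) = _
  rw [← (R i).res_comp, ofSmall_counit, (R i).res_id]

/-- The element given by a generator. -/
noncomputable def termOf {c : SmallModel.{w} (FinGSet G)} (x : gen c) :
    (termModel R v).obj (ofSmall.obj c) := termMk R v (.of x)

theorem termEval_termOf (i : I) {c : SmallModel.{w} (FinGSet G)} (x : gen c) :
    (termEval R v i).app _ (termOf R v x) = v i c x := termEval_termMk R v i _

/-- Morphisms out of `termModel` are determined by their values on generators. -/
theorem termModel_hom_ext {S : SemiMackeyFunctor.{u, w} G} {φ ψ : termModel R v ⟶ S}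
    (h : ∀ (c : SmallModel.{w} (FinGSet G)) (x : gen c),
      φ.app _ (termOf R v x) = ψ.app _ (termOf R v x)) : φ = ψ := by
  have key : ∀ {c : SmallModel.{w} (FinGSet G)} (t : Term gen c),
      φ.app _ (termMk R v t) = ψ.app _ (termMk R v t) := by
    intro c t
    induction t with
    | of x => exact h _ x
    | one c =>
      have e : termMk R v (.one c) = 1 := termModel_ext R v fun i => by
        rw [termEval_termMk, map_one, Term.eval]
      rw [e, map_one, map_one]
    | times s t ihs iht =>
      have e : termMk R v (s.times t) = termMk R v s * termMk R v t := termModel_ext R v fun i => by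
        rw [map_mul, termEval_termMk, termEval_termMk, termEval_termMk, Term.eval]
      rw [e, map_mul, map_mul, ihs, iht]
    | res f t ih =>
      have e : termMk R v (t.res f) = (termModel R v).res (ofSmall.map f) (termMk R v t) :=
        termModel_ext R v fun i => by
          rw [Hom.app_res, termEval_termMk, termEval_termMk, Term.eval]
      rw [e, Hom.app_res, Hom.app_res, ih]
    | tr f t ih =>
      have e : termMk R v (t.tr f) = (termModel R v).tr (ofSmall.map f) (termMk R v t) :=
        termModel_ext R v fun i => by
          rw [Hom.app_tr, termEval_termMk, termEval_termMk, Term.eval]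
      rw [e, Hom.app_tr, Hom.app_tr, ih]
  refine hom_ext fun X a => ?_
  obtain ⟨t, rfl⟩ := Quotient.exists_rep a
  have e : Quotient.mk (termSetoid R v X) t =
      (termModel R v).res (smallIso X).hom (termMk R v t) := termModel_ext R v fun i => by
    rw [Hom.app_res, termEval_termMk]
    rfl
  rw [e, Hom.app_res, Hom.app_res, key]

section freeFixed

variable (Q : CommMonCat.{w})

/-- The semi-Mackey functors with a homomorphism from `Q` to the fixed part at `G/e`. -/
abbrev FixedModels (G : Type u) [Group G] [Finite G] :=
  Σ R : SemiMackeyFunctor.{u, w} G, (Q ⟶ (evFixed G).obj R)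

/-- The generators: the elements of `Q` at `G/e` and their formal restrictions. -/
abbrev FixedGen (G : Type u) [Group G] [Finite G] (c : SmallModel.{w} (FinGSet G)) : Type w :=
  Q × (c ⟶ toSmall.{u, w}.obj (regular G))

/-- The element of `M(G/e)` given by a homomorphism to the fixed part. -/
def fixedElt {Q : CommMonCat.{w}} {R : SemiMackeyFunctor.{u, w} G} (h : Q ⟶ (evFixed G).obj R)
    (q : Q) : R.obj (regular G) :=
  (show fixedPart R from h.hom q).1

/-- The values of the generators in a model. -/
noncomputable def fixedVal (i : FixedModels Q G) (c : SmallModel.{w} (FinGSet G))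
    (x : FixedGen Q G c) : i.1.obj (ofSmall.obj c) :=
  i.1.res (ofSmall.map x.2 ≫ (smallIso (regular G)).inv) (fixedElt i.2 x.1)

variable (G) in
/-- The semi-Mackey functor freely generated by the commutative monoid `Q` in the fixed part of
its value at `G/e`. -/
noncomputable def freeFixed : SemiMackeyFunctor.{u, w} G :=
  termModel (fun i : FixedModels Q G => i.1) (fixedVal Q)

variable (G) in
/-- The elements of the free object at `G/e` given by `Q`. -/
noncomputable def freeFixedOf (q : Q) : (freeFixed G Q).obj (regular G) :=
  (freeFixed G Q).res (smallIso (regular G)).hom (termOf _ (fixedVal Q) (q, 𝟙 _))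

theorem termEval_freeFixedOf (i : FixedModels Q G) (q : Q) :
    (termEval (fun i : FixedModels Q G => i.1) (fixedVal Q) i).app _ (freeFixedOf G Q q) =
      fixedElt i.2 q := by
  refine ((termEval _ _ i).app_res _ _).trans ?_
  rw [termEval_termOf, fixedVal, ← i.1.res_comp]
  have e : (smallIso (regular G)).hom ≫ ofSmall.map (𝟙 (toSmall.{u, w}.obj (regular G))) ≫
      (smallIso (regular G)).inv = 𝟙 (regular G) := by
    rw [CategoryTheory.Functor.map_id, Category.id_comp, Iso.hom_inv_id]
  rw [e, i.1.res_id]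

variable (G) in
/-- The homomorphism from `Q` to the fixed part of the free object. -/
noncomputable def freeFixedHom : Q →* fixedPart (freeFixed G Q) where
  toFun q := ⟨freeFixedOf G Q q, fun g => termModel_ext _ _ fun i => by
    refine ((termEval _ _ i).app_res _ _).trans ?_
    rw [termEval_freeFixedOf]
    exact (show fixedPart i.1 from i.2.hom q).2 g⟩
  map_one' := Subtype.ext (termModel_ext _ _ fun i => (termEval_freeFixedOf ..).trans
    ((congrArg Subtype.val (map_one i.2.hom)).trans (map_one ((termEval _ _ i).app _)).symm))
  map_mul' a b := Subtype.ext (termModel_ext _ _ fun i => (termEval_freeFixedOf ..).trans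
    ((congrArg Subtype.val (map_mul i.2.hom a b)).trans
      (.trans (congrArg₂ _ (termEval_freeFixedOf ..).symm (termEval_freeFixedOf ..).symm)
        (map_mul ((termEval _ _ i).app (regular G)) _ _).symm)))

/-- The unit of the adjunction. -/
noncomputable def freeFixedUnit : Q ⟶ (evFixed G).obj (freeFixed G Q) :=
  CommMonCat.ofHom (freeFixedHom G Q)

theorem freeFixedUnit_eval (i : FixedModels Q G) :
    freeFixedUnit Q ≫ (evFixed G).map (termEval _ (fixedVal Q) i) = i.2 :=
  CommMonCat.hom_ext (MonoidHom.ext fun q =>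
    Subtype.ext (p := (· ∈ fixedPart i.1)) (termEval_freeFixedOf Q i q))

variable {Q}

theorem freeFixed_hom_ext {R : SemiMackeyFunctor.{u, w} G} {φ ψ : freeFixed G Q ⟶ R}
    (h : freeFixedUnit Q ≫ (evFixed G).map φ = freeFixedUnit Q ≫ (evFixed G).map ψ) : φ = ψ := by
  refine termModel_hom_ext _ _ fun c x => ?_
  have e : termOf _ (fixedVal Q) x = (freeFixed G Q).res
      (ofSmall.map x.2 ≫ (smallIso (regular G)).inv) (freeFixedOf G Q x.1) :=
    termModel_ext _ _ fun i => by
      rw [termEval_termOf]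
      refine .trans ?_ ((termEval _ _ i).app_res _ _).symm
      rw [termEval_freeFixedOf]
      rfl
  rw [e]
  refine (φ.app_res _ _).trans (.trans (congrArg _ ?_) (ψ.app_res _ _).symm)
  exact congrArg (fun k : Q ⟶ (evFixed G).obj R => fixedElt k x.1) h

variable (G) in
theorem isRightAdjoint_evFixed : (evFixed.{u, w} G).IsRightAdjoint :=
  (Adjunction.adjunctionOfEquivLeft (G := evFixed.{u, w} G)
    (F_obj := freeFixed G)
    (fun Q R =>
      { toFun := fun φ => freeFixedUnit Q ≫ (evFixed G).map φ
        invFun := fun ψ => termEval _ _ (⟨R, ψ⟩ : FixedModels Q G)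
        left_inv := fun φ => freeFixed_hom_ext
          (freeFixedUnit_eval Q ⟨R, freeFixedUnit Q ≫ (evFixed G).map φ⟩)
        right_inv := fun ψ => freeFixedUnit_eval Q ⟨R, ψ⟩ })
    (fun _ _ _ _ _ => rfl)).isRightAdjoint

end freeFixed

end SemiMackeyFunctor

namespace FinGSet

variable {G : Type u} [Group G]

/-- The unique map to the one-point set. -/
def toPoint (X : FinGSet G) : X ⟶ point G :=
  mkHom (Y := point G) (fun _ => PUnit.unit) fun _ _ => rfl

theorem toPoint_unique {X : FinGSet G} (f h : X ⟶ point G) : f = h := hom_ext fun _ => rfl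

end FinGSet

/-! ### Morphisms out of the additive Burnside functor -/

namespace SemiMackeyFunctor

variable {G : Type u} [Group G] (M : SemiMackeyFunctor.{u, w} G)

theorem tr_res_iso {X Y : FinGSet G} (f : X ⟶ Y) [IsIso f] (m : M.obj Y) :
    M.tr f (M.res f m) = m := by
  have sq : IsPullback f f (𝟙 Y) (𝟙 Y) := IsPullback.of_horiz_isIso ⟨rfl⟩
  rw [← M.mackey sq, M.res_id, M.tr_id]

/-- The homomorphism from the classes of finite `G`-sets over `X` to `M(X)` determined by an
element of `M(G/G)`. -/
def burnsideApp (m : M.obj (point G)) (X : FinGSet G) : Burnside.IsoClass X →* M.obj X where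
  toFun := Quotient.lift (fun a : Over X => M.tr a.hom (M.res (toPoint a.left) m)) (by
    rintro a b ⟨i⟩
    have : IsIso i.hom.left := ((Over.forget X).mapIso i).isIso_hom
    change M.tr a.hom (M.res (i.hom.left ≫ toPoint b.left) m) = _
    rw [← Over.w i.hom, M.res_comp, M.tr_comp, M.tr_res_iso])
  map_one' := by
    have := M.additive_empty
    change M.tr (Burnside.fromEmpty X) (M.res (toPoint _) m) = 1
    rw [Subsingleton.elim (M.res _ m) 1, map_one]
  map_mul' c d := by
    induction c using Burnside.cls_ind with | h A a
    induction d using Burnside.cls_ind with | h B b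
    change M.tr (sumDesc a b) (M.res (toPoint (FinGSet.sum A B)) m) =
      M.tr a (M.res (inl A B ≫ toPoint (FinGSet.sum A B)) m) *
        M.tr b (M.res (inr A B ≫ toPoint (FinGSet.sum A B)) m)
    conv_lhs => rw [← M.tr_inl_mul_tr_inr (M.res (toPoint (FinGSet.sum A B)) m)]
    rw [map_mul, ← M.tr_comp, ← M.tr_comp, ← M.res_comp, ← M.res_comp]
    rfl

theorem burnsideApp_cls (m : M.obj (point G)) {A X : FinGSet G} (a : A ⟶ X) :
    M.burnsideApp m X (Burnside.cls a) = M.tr a (M.res (toPoint A) m) := rfl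

theorem burnsideApp_res (m : M.obj (point G)) {X Y : FinGSet G} (f : X ⟶ Y)
    (c : Burnside.IsoClass Y) :
    M.burnsideApp m X (Burnside.res f c) = M.res f (M.burnsideApp m Y c) := by
  induction c using Burnside.cls_ind with | h A a
  rw [Burnside.res_cls, burnsideApp_cls, burnsideApp_cls,
    M.mackey (isPullback_fiberProd f a).flip, ← M.res_comp]
  rfl

theorem burnsideApp_tr (m : M.obj (point G)) {X Y : FinGSet G} (f : X ⟶ Y)
    (c : Burnside.IsoClass X) :
    M.burnsideApp m Y (Burnside.tr f c) = M.tr f (M.burnsideApp m X c) := by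
  induction c using Burnside.cls_ind with | h A a
  rw [Burnside.tr_cls, burnsideApp_cls, burnsideApp_cls, M.tr_comp]

end SemiMackeyFunctor

namespace Burnside

variable {G : Type u} [Group G]

theorem cls_eq_tr_res {A X : FinGSet G} (a : A ⟶ X) :
    cls a = tr a (res (toPoint A) (cls (𝟙 (point G)))) := by
  rw [res_cls, tr_cls]
  exact cls_eq_of_equiv (B := fiberProd (toPoint A) (𝟙 (point G)))
    ⟨fun x => ⟨(x, PUnit.unit), rfl⟩, fun t => t.1.1, fun _ => rfl, fun _ => rfl⟩
    (fun _ _ => rfl) (fun _ => rfl)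

end Burnside

namespace SemiMackeyFunctor

variable {G : Type u} [Group G] [Finite G]

/-- The class of `G/G` over itself. -/
noncomputable def burnsideGen (G : Type u) [Group G] [Finite G] :
    (burnsideAdd.{u, w} G).obj (point G) :=
  equivShrink.{w} _ (Burnside.cls (𝟙 (point G)))

theorem burnsideAdd_res {X Y : FinGSet G} (f : X ⟶ Y) (c : (burnsideAdd.{u, w} G).obj Y) :
    (burnsideAdd.{u, w} G).res f c = equivShrink.{w} _ (Burnside.res f ((equivShrink.{w} _).symm c)) := rfl

theorem burnsideAdd_tr {X Y : FinGSet G} (f : X ⟶ Y) (c : (burnsideAdd.{u, w} G).obj X) :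
    (burnsideAdd.{u, w} G).tr f c = equivShrink.{w} _ (Burnside.tr f ((equivShrink.{w} _).symm c)) := rfl

theorem burnsideAdd_eq_tr_res {A X : FinGSet G} (a : A ⟶ X) :
    (equivShrink.{w} _ (Burnside.cls a) : (burnsideAdd.{u, w} G).obj X) =
      (burnsideAdd G).tr a ((burnsideAdd G).res (toPoint A) (burnsideGen G)) := by
  conv_lhs => rw [Burnside.cls_eq_tr_res]
  change _ = equivShrink.{w} _ (Burnside.tr a ((equivShrink.{w} _).symm (equivShrink.{w} _
    (Burnside.res _ ((equivShrink.{w} _).symm (equivShrink.{w} _ (Burnside.cls (𝟙 _))))))))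
  rw [Equiv.symm_apply_apply, Equiv.symm_apply_apply]

/-- Morphisms from the additive Burnside functor to `M` are the elements of `M(G/G)`. -/
noncomputable def burnsideEquiv (M : SemiMackeyFunctor.{u, w} G) :
    (burnsideAdd G ⟶ M) ≃ M.obj (point G) where
  toFun φ := φ.app _ (burnsideGen G)
  invFun m :=
    { app := fun X => (M.burnsideApp m X).comp
        (Shrink.mulEquiv.{w} (α := Burnside.IsoClass X)).toMonoidHom
      app_res := fun f c => by
        change M.burnsideApp m _ ((equivShrink.{w} _).symm ((burnsideAdd.{u, w} G).res f c)) =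
          M.res f (M.burnsideApp m _ ((equivShrink.{w} _).symm c))
        rw [burnsideAdd_res, Equiv.symm_apply_apply, burnsideApp_res]
      app_tr := fun f c => by
        change M.burnsideApp m _ ((equivShrink.{w} _).symm ((burnsideAdd.{u, w} G).tr f c)) =
          M.tr f (M.burnsideApp m _ ((equivShrink.{w} _).symm c))
        rw [burnsideAdd_tr, Equiv.symm_apply_apply, burnsideApp_tr] }
  left_inv φ := hom_ext fun X c => by
    obtain ⟨c, rfl⟩ := (equivShrink.{w} _).surjective c
    induction c using Burnside.cls_ind with | h A a
    rw [burnsideAdd_eq_tr_res, φ.app_tr, φ.app_res, ← burnsideAdd_eq_tr_res]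
    change M.burnsideApp _ X ((equivShrink.{w} _).symm (equivShrink.{w} _ (Burnside.cls a))) = _
    rw [Equiv.symm_apply_apply, burnsideApp_cls]
  right_inv m := by
    change M.burnsideApp _ _ ((equivShrink.{w} _).symm (equivShrink.{w} _ (Burnside.cls (𝟙 _)))) = _
    rw [Equiv.symm_apply_apply, burnsideApp_cls, M.tr_id]
    exact M.res_id _ m

end SemiMackeyFunctor

namespace TambaraFunctor

variable {G : Type u} [Group G]

section genDress

variable [HasBinaryCoproducts (TambaraFunctor.{u, w} G)] [(multPart.{u, w} G).IsRightAdjoint]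

/-- Morphisms `𝓕(T, M) ⟶ S` of `T`-Tambara functors are morphisms `M ⟶ S^μ`. -/
noncomputable def genDressEquiv (M : SemiMackeyFunctor.{u, w} G) (T : TambaraFunctor.{u, w} G)
    (S : Under T) :
    (Under.mk (Y := ((genDress G).flip.obj M).obj T) ((genDressUnit G M).app T) ⟶ S) ≃
      (M ⟶ (multPart G).obj S.right) :=
  Equiv.trans
    { toFun := fun φ => (coprod.inr : _ ⟶ T ⨿ (multPart.{u, w} G).leftAdjoint.obj M) ≫ φ.right
      invFun := fun χ => Under.homMk (coprod.desc S.hom χ) (coprod.inl_desc _ _)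
      left_inv := fun φ => by
        refine Under.UnderMorphism.ext (coprod.hom_ext ?_ ?_)
        · exact (coprod.inl_desc _ _).trans (Under.w φ).symm
        · exact coprod.inr_desc _ _
      right_inv := fun χ => coprod.inr_desc _ _ }
    ((Adjunction.ofIsRightAdjoint (multPart.{u, w} G)).homEquiv M S.right)

/-- The bijections for `T ↦ 𝓕(T, M)` given by a description of the morphisms `M ⟶ S^μ`. -/
noncomputable def genDressNatBij (M : SemiMackeyFunctor.{u, w} G)
    (E : TambaraFunctor.{u, w} G ⥤ Type w)
    (ε : ∀ S, (M ⟶ (multPart G).obj S) ≃ E.obj S)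
    (hε : ∀ (S S' : TambaraFunctor.{u, w} G) (ψ : S ⟶ S') (χ : M ⟶ (multPart G).obj S),
      ε S' (χ ≫ (multPart G).map ψ) = E.map ψ (ε S χ)) :
    NatBij ((genDress G).flip.obj M) (genDressUnit G M) E where
  equiv T S := (genDressEquiv M T S).trans (ε S.right)
  naturality_right T S S' ψ φ := by
    refine .trans (congrArg (ε S'.right) ?_) (hε _ _ _ _)
    refine .trans (congrArg ((Adjunction.ofIsRightAdjoint (multPart.{u, w} G)).homEquiv M S'.right)
      ?_) (Adjunction.homEquiv_naturality_right _ _ _)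
    exact (Category.assoc _ φ.right ψ.right).symm
  naturality_left τ S φ := by
    refine congrArg (ε S.right) ?_
    refine congrArg ((Adjunction.ofIsRightAdjoint (multPart.{u, w} G)).homEquiv M S.right) ?_
    exact (coprod.inr_map_assoc τ (𝟙 ((multPart.{u, w} G).leftAdjoint.obj M)) φ.right).trans
      (Category.id_comp _)

/-- The bijections for `T[X]`. -/
noncomputable def polXNatBij [Finite G] :
    NatBij (polX.{u, w} G) (polXUnit G) (evPoint.{u, w} G) :=
  genDressNatBij (burnsideAdd G) _ (fun S => SemiMackeyFunctor.burnsideEquiv ((multPart G).obj S))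
    fun S S' ψ χ => by
      change (χ ≫ (multPart G).map ψ).app _ _ = ψ.app _ (χ.app _ _)
      rfl

/-- Homomorphisms from the free commutative monoid on one generator are elements. -/
def natHomEquiv (Q : CommMonCat.{w}) :
    (CommMonCat.of (Multiplicative (ULift.{w} ℕ)) ⟶ Q) ≃ Q where
  toFun φ := φ.hom (Multiplicative.ofAdd (ULift.up 1))
  invFun q := CommMonCat.ofHom ((powersHom Q q).comp
    (AddMonoidHom.toMultiplicative AddEquiv.ulift.toAddMonoidHom))
  left_inv φ := CommMonCat.hom_ext (MonoidHom.ext fun n =>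
    (map_pow φ.hom (Multiplicative.ofAdd (ULift.up 1)) n.toAdd.down).symm.trans
      (congrArg φ.hom (Multiplicative.toAdd.injective (ULift.ext _ _ (Nat.mul_one _)))))
  right_inv q := pow_one q

/-- The bijections for `T[x]`. -/
noncomputable def polxNatBij [Finite G] [(SemiMackeyFunctor.evFixed.{u, w} G).IsRightAdjoint] :
    NatBij (polx.{u, w} G) (polxUnit G) (evFixedPoints.{u, w} G) :=
  genDressNatBij (freeFixedNat G) _
    (fun S => ((Adjunction.ofIsRightAdjoint (SemiMackeyFunctor.evFixed.{u, w} G)).homEquiv _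
      ((multPart G).obj S)).trans (natHomEquiv _))
    fun S S' ψ χ => by
      refine congrArg (natHomEquiv _) ((Adjunction.ofIsRightAdjoint
        (SemiMackeyFunctor.evFixed.{u, w} G)).homEquiv_naturality_right χ ((multPart G).map ψ))

end genDress

end TambaraFunctor

namespace FinGSet

variable {G : Type u} [Group G] [Subsingleton G]

theorem smul_eq_of_subsingleton {α : Type*} [MulAction G α] (g : G) (x : α) : g • x = x := by
  rw [Subsingleton.elim g 1, one_smul]

/-- The map from the one-point set given by an element. -/
def ofPoint {X : FinGSet G} (x : X) : point G ⟶ X :=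
  mkHom (X := point G) (fun _ => x) fun g _ => (smul_eq_of_subsingleton g x).symm

theorem ofPoint_comp {X Y : FinGSet G} (f : X ⟶ Y) (x : X) : ofPoint x ≫ f = ofPoint (f x) := rfl

end FinGSet

/-! ### Semi-Mackey functors on the trivial group -/

namespace SemiMackeyFunctor

variable {G : Type u} [Group G] [Subsingleton G] (M : SemiMackeyFunctor.{u, w} G)

theorem ext_ofPoint {X : FinGSet G} {m n : M.obj X}
    (h : ∀ x : X, M.res (ofPoint x) m = M.res (ofPoint x) n) : m = n := by
  let P : Type u → Prop := fun α => ∀ (_ : MulAction G α) (_ : Finite α)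
    (m n : M.obj (FinGSet.mk α)),
    (∀ x : FinGSet.mk (G := G) α, M.res (ofPoint x) m = M.res (ofPoint x) n) → m = n
  have key : ∀ α : Type u, Finite α → P α := fun α hα => by
    refine Finite.induction_empty_option (P := P) ?_ ?_ ?_ α
    · intro α β e hα _ _ m n h
      let _ : MulAction G α :=
        { smul := fun _ x => x
          one_smul := fun _ => rfl
          mul_smul := fun _ _ _ => rfl }
      have : Finite α := Finite.of_equiv β e.symm
      let i : FinGSet.mk (G := G) α ≅ FinGSet.mk β :=
        isoOfEquiv (X := FinGSet.mk (G := G) α) (Y := FinGSet.mk (G := G) β) e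
          fun g x => (smul_eq_of_subsingleton (G := G) g (e x)).symm
      have := hα inferInstance inferInstance (M.res i.hom m) (M.res i.hom n) fun x => by
        rw [← M.res_comp, ← M.res_comp, ofPoint_comp, h]
      rw [← M.res_id _ m, ← M.res_id _ n, ← i.inv_hom_id, M.res_comp, M.res_comp, this]
    · intro _ _ m n _
      have := M.additive_empty
      let i : FinGSet.mk (G := G) PEmpty.{u + 1} ≅ FinGSet.empty G :=
        isoOfEquiv (X := FinGSet.mk (G := G) PEmpty) (Y := FinGSet.empty G) (Equiv.refl _)
          fun _ x => PEmpty.elim x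
      rw [← M.res_id _ m, ← M.res_id _ n, ← i.hom_inv_id, M.res_comp, M.res_comp,
        Subsingleton.elim (M.res i.inv m) (M.res i.inv n)]
    · intro α _ hα _ _ m n h
      let _ : MulAction G α :=
        { smul := fun _ x => x
          one_smul := fun _ => rfl
          mul_smul := fun _ _ _ => rfl }
      let A : FinGSet G := FinGSet.mk (G := G) α
      let i : FinGSet.mk (G := G) (Option α) ≅ FinGSet.sum A (point G) :=
        isoOfEquiv (X := FinGSet.mk (G := G) (Option α)) (Y := FinGSet.sum A (point G))
          (Equiv.optionEquivSumPUnit α)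
          fun g x => by rw [smul_eq_of_subsingleton, smul_eq_of_subsingleton]
      have e : M.res i.inv m = M.res i.inv n := by
        refine (M.additive_sum _ _).1 (Prod.ext ?_ ?_)
        · refine hα inferInstance inferInstance _ _ fun x => ?_
          rw [← M.res_comp, ← M.res_comp, ← M.res_comp, ← M.res_comp]
          exact h (i.inv (inl A (point G) x))
        · change M.res _ _ = M.res _ _
          rw [← M.res_comp, ← M.res_comp]
          exact h (i.inv (inr A (point G) PUnit.unit))
      rw [← M.res_id _ m, ← M.res_id _ n, ← i.hom_inv_id, M.res_comp, M.res_comp, e]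
  exact key X inferInstance _ _ m n h

open Classical in
theorem res_ofPoint_tr_ofPoint {X : FinGSet G} (x y : X) (m : M.obj (point G)) :
    M.res (ofPoint y) (M.tr (ofPoint x) m) = if x = y then m else 1 := by
  split_ifs with h
  · subst h
    exact M.res_tr_self _ (fun _ _ _ => rfl) m
  · exact M.res_tr_disjoint _ _ (fun _ _ e => h e) m

theorem finprod_tr_ofPoint {X : FinGSet G} (a : X → M.obj (point G)) (z : X) :
    M.res (ofPoint z) (∏ᶠ x : X, M.tr (ofPoint x) (a x)) = a z := by
  classical
  cases nonempty_fintype X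
  rw [finprod_eq_prod_of_fintype, map_prod]
  simp only [res_ofPoint_tr_ofPoint]
  rw [Finset.prod_ite_eq' Finset.univ z a, if_pos (Finset.mem_univ z)]

theorem eq_finprod_tr_res {X : FinGSet G} (m : M.obj X) :
    m = ∏ᶠ x : X, M.tr (ofPoint x) (M.res (ofPoint x) m) :=
  M.ext_ofPoint fun z => (M.finprod_tr_ofPoint (fun x => M.res (ofPoint x) m) z).symm

theorem res_ofPoint_tr {X Y : FinGSet G} (f : X ⟶ Y) (m : M.obj X) (y : Y) :
    M.res (ofPoint y) (M.tr f m) = ∏ᶠ x : {x : X // f x = y}, M.res (ofPoint x.1) m := by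
  classical
  cases nonempty_fintype X
  conv_lhs => rw [M.eq_finprod_tr_res m]
  rw [finprod_eq_prod_of_fintype, map_prod, map_prod]
  simp only [← M.tr_comp, ofPoint_comp, res_ofPoint_tr_ofPoint]
  rw [finprod_eq_prod_of_fintype, ← Finset.prod_filter]
  exact Finset.prod_subtype _ (fun x => by simp) _

end SemiMackeyFunctor

/-! ### Products over fibers -/

section pushforward

variable {α β γ : Type*}

/-- The product over the fibers of a map. -/
@[to_additive /-- The sum over the fibers of a map. -/]
noncomputable def prodFibers {N : Type*} [CommMonoid N] (f : α → β) (φ : α → N) (y : β) : N :=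
  ∏ᶠ x : {x // f x = y}, φ x.1

variable {N : Type*} [CommMonoid N]

@[to_additive]
theorem prodFibers_id (φ : α → N) : prodFibers (fun x => x) φ = φ :=
  funext fun y => finprod_unique (α := {x // x = y}) fun x => φ x.1

@[to_additive]
theorem prodFibers_one (f : α → β) : prodFibers f (1 : α → N) = 1 :=
  funext fun _ => finprod_one

@[to_additive]
theorem prodFibers_mul [Finite α] (f : α → β) (φ ψ : α → N) :
    prodFibers f (φ * ψ) = prodFibers f φ * prodFibers f ψ :=
  funext fun _ => finprod_mul_distrib (Set.toFinite _) (Set.toFinite _)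

@[to_additive]
theorem prodFibers_comp [Finite α] [Finite β] (f : α → β) (h : β → γ) (φ : α → N) :
    prodFibers (fun x => h (f x)) φ = prodFibers h (prodFibers f φ) := by
  classical
  cases nonempty_fintype α
  cases nonempty_fintype β
  funext z
  simp only [prodFibers, finprod_eq_prod_of_fintype]
  rw [← Fintype.prod_sigma']
  exact Fintype.prod_equiv
    { toFun := fun x : {x // h (f x) = z} => (⟨⟨f x.1, x.2⟩, ⟨x.1, rfl⟩⟩ :
        Σ y : {y // h y = z}, {x // f x = y.1})
      invFun := fun t => ⟨t.2.1, (congrArg h t.2.2).trans t.1.2⟩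
      left_inv := fun _ => rfl
      right_inv := fun ⟨⟨y, hy⟩, ⟨x, hx⟩⟩ => by
        obtain rfl : f x = y := hx
        rfl } _ _ fun _ => rfl

@[to_additive]
theorem prodFibers_baseChange {δ : Type*} {f' : δ → β} {x : δ → α} {y : β → γ} {f : α → γ}
    (hw : ∀ d, y (f' d) = f (x d)) (hu : ∀ b a, y b = f a → ∃! d, f' d = b ∧ x d = a)
    (φ : β → N) (a : α) :
    prodFibers y φ (f a) = prodFibers x (fun d => φ (f' d)) a := by
  refine (finprod_eq_of_bijective (fun d : {d // x d = a} => (⟨f' d.1, by rw [hw, d.2]⟩ :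
    {b // y b = f a})) ⟨?_, ?_⟩ fun _ => rfl).symm
  · intro d e h
    have h' : f' d.1 = f' e.1 := congrArg Subtype.val h
    exact Subtype.ext ((hu _ a (by rw [hw, e.2])).unique ⟨h', d.2⟩ ⟨rfl, e.2⟩)
  · rintro ⟨b, hb⟩
    obtain ⟨d, ⟨h1, h2⟩, -⟩ := hu b a hb
    exact ⟨⟨d, h2⟩, Subtype.ext h1⟩

end pushforward

theorem finprod_finsum_eq {ι R : Type*} [CommRing R] [Finite ι] {κ : ι → Type*}
    [∀ i, Finite (κ i)] (φ : ∀ i, κ i → R) :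
    ∏ᶠ i, ∑ᶠ k : κ i, φ i k = ∑ᶠ σ : ∀ i, κ i, ∏ᶠ i, φ i (σ i) := by
  classical
  cases nonempty_fintype ι
  have := fun i => Fintype.ofFinite (κ i)
  simp only [finsum_eq_sum_of_fintype, finprod_eq_prod_of_fintype]
  rw [Finset.prod_univ_sum, Fintype.piFinset_univ]

section

variable {G : Type u} [Group G]

/-- Products of sums over the fibers of a map are sums of products, over an exponential diagram. -/
theorem prodFibers_sumFibers {N : Type*} [CommRing N] {A X Y Z B : FinGSet G} {f : X ⟶ Y}
    {p : A ⟶ X} {lam : Z ⟶ A} {rho : Z ⟶ B} {q : B ⟶ Y} (h : IsExponential f p lam rho q)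
    (φ : A → N) :
    prodFibers f (sumFibers p φ) = sumFibers q (prodFibers rho fun z => φ (lam z)) := by
  obtain ⟨i, j, h1, h2, h3⟩ := h
  have hi : ∀ t, i.hom (i.inv t) = t := DFunLike.congr_fun i.inv_hom_id
  have hi' : ∀ z, i.inv (i.hom z) = z := DFunLike.congr_fun i.hom_inv_id
  have hj : ∀ s, j.hom (j.inv s) = s := DFunLike.congr_fun j.inv_hom_id
  have hj' : ∀ b, j.inv (j.hom b) = b := DFunLike.congr_fun j.hom_inv_id
  have hlam : ∀ t, piEval f p t = lam (i.inv t) := fun t =>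
    (congrArg (piEval f p) (hi t)).symm.trans (DFunLike.congr_fun h1 (i.inv t))
  have hrho : ∀ t : fiberProd f (piProj f p), rho (i.inv t) = j.inv t.1.2 := fun t =>
    (hj' _).symm.trans (congrArg j.inv ((DFunLike.congr_fun h2 (i.inv t)).symm.trans
      (congrArg (fiberSnd f (piProj f p)) (hi t))))
  have hq : ∀ s : piSet f p, q (j.inv s) = s.1 := fun s =>
    (DFunLike.congr_fun h3 (j.inv s)).symm.trans (congrArg (piProj f p) (hj s))
  funext y
  let mk : (∀ x : {x // f x = y}, {a // p a = x.1}) → piSet f p := fun σ =>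
    ⟨y, fun x => (σ x).1, fun x => (σ x).2⟩
  refine (finprod_finsum_eq fun (x : {x // f x = y}) (a : {a // p a = x.1}) => φ a.1).trans ?_
  refine finsum_eq_of_bijective (fun σ => (⟨j.inv (mk σ), hq (mk σ)⟩ : {b // q b = y}))
    ⟨fun σ τ e => ?_, fun ⟨b, hb⟩ => ?_⟩ fun σ => ?_
  · have e' : mk σ = mk τ :=
      (hj _).symm.trans ((congrArg (fun b : {b // q b = y} => j.hom b.1) e).trans (hj _))
    have e'' := eq_of_heq (Sigma.mk.inj e').2
    exact funext fun x => Subtype.ext (congrFun (congrArg Subtype.val e'') x)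
  · obtain ⟨⟨y', σ, hσ⟩, rfl⟩ : ∃ s, j.inv s = b := ⟨j.hom b, hj' b⟩
    obtain rfl : y' = y := (hq _).symm.trans hb
    exact ⟨fun x => ⟨σ x, hσ x⟩, rfl⟩
  · let mk' : {x // f x = y} → fiberProd f (piProj f p) := fun x => ⟨(x.1, mk σ), x.2⟩
    refine finprod_eq_of_bijective (fun x =>
      (⟨i.inv (mk' x), hrho (mk' x)⟩ : {z // rho z = j.inv (mk σ)}))
      ⟨fun x x' e => ?_, fun ⟨z, hz⟩ => ?_⟩ fun x => congrArg φ (hlam (mk' x))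
    · have e' : mk' x = mk' x' := (hi _).symm.trans
        ((congrArg (fun z : {z // rho z = j.inv (mk σ)} => i.hom z.1) e).trans (hi _))
      exact Subtype.ext (congrArg (fun t : fiberProd f (piProj f p) => t.1.1) e')
    · obtain ⟨⟨⟨x, s⟩, hx⟩, rfl⟩ : ∃ t, i.inv t = z := ⟨i.hom z, hi' z⟩
      obtain rfl : s = mk σ :=
        (hj s).symm.trans ((congrArg j.hom ((hrho _).symm.trans hz)).trans (hj _))
      exact ⟨⟨x, hx⟩, rfl⟩

end

namespace TambaraFunctor

variable {G : Type u} [Group G] {N : Type w} {X Y : FinGSet G}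

/-- The functions on a finite `G`-set with values in `N`, in the universe of `N`. -/
def Functions (X : FinGSet G) (N : Type w) : Type w := Shrink.{w} X → N

namespace Functions

/-- The value of a function at a point. -/
noncomputable def val (φ : Functions X N) (x : X) : N := φ (equivShrink.{w} X x)

/-- The function with given values. -/
noncomputable def mk (φ : X → N) : Functions X N := fun x => φ ((equivShrink.{w} X).symm x)

theorem val_mk (φ : X → N) : (mk φ).val = φ :=
  funext fun x => congrArg φ (Equiv.symm_apply_apply (equivShrink.{w} X) x)

theorem ext {φ ψ : Functions X N} (h : φ.val = ψ.val) : φ = ψ := funext fun x => by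
  obtain ⟨x, rfl⟩ := (equivShrink.{w} X).surjective x
  exact congrFun h x

variable [CommRing N]

instance : CommRing (Functions X N) := inferInstanceAs (CommRing (Shrink.{w} X → N))

theorem val_zero : (0 : Functions X N).val = 0 := rfl

theorem val_one : (1 : Functions X N).val = 1 := rfl

theorem val_add (φ ψ : Functions X N) : (φ + ψ).val = φ.val + ψ.val := rfl

theorem val_mul (φ ψ : Functions X N) : (φ * ψ).val = φ.val * ψ.val := rfl

/-- Restriction by composition. -/
noncomputable def res (f : X ⟶ Y) : Functions Y N →+* Functions X N where
  toFun φ := mk fun x => φ.val (f x)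
  map_one' := rfl
  map_zero' := rfl
  map_mul' _ _ := rfl
  map_add' _ _ := rfl

/-- Additive transfer by sums over fibers. -/
noncomputable def tradd (f : X ⟶ Y) : Functions X N →+ Functions Y N where
  toFun φ := mk (sumFibers f φ.val)
  map_zero' := ext (by rw [val_mk, val_zero, val_zero, sumFibers_zero])
  map_add' φ ψ := ext (by rw [val_add, val_add, val_mk, val_mk, val_mk, sumFibers_add])

/-- Multiplicative transfer by products over fibers. -/
noncomputable def trmul (f : X ⟶ Y) : Functions X N →* Functions Y N where
  toFun φ := mk (prodFibers f φ.val)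
  map_one' := ext (by rw [val_mk, val_one, val_one, prodFibers_one])
  map_mul' φ ψ := ext (by rw [val_mul, val_mul, val_mk, val_mk, val_mk, prodFibers_mul])

theorem val_res (f : X ⟶ Y) (φ : Functions Y N) : (res f φ).val = fun x => φ.val (f x) :=
  val_mk (fun x => φ.val (f x))

theorem val_tradd (f : X ⟶ Y) (φ : Functions X N) : (tradd f φ).val = sumFibers f φ.val :=
  val_mk (sumFibers f φ.val)

theorem val_trmul (f : X ⟶ Y) (φ : Functions X N) : (trmul f φ).val = prodFibers f φ.val :=
  val_mk (prodFibers f φ.val)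

end Functions

open Functions in
variable (G) in
/-- The Tambara functor of functions with values in a commutative ring, with restriction by
composition and transfers by sums and products over fibers. It ignores the action. -/
noncomputable def functions (N : Type w) [CommRing N] : TambaraFunctor.{u, w} G where
  obj X := Functions X N
  res f := Functions.res f
  add f := Functions.tradd f
  mul f := Functions.trmul f
  res_id X φ := Functions.ext (val_res _ _)
  res_comp f h φ := Functions.ext (by rw [val_res, val_res, val_res]; rfl)
  add_id X φ := Functions.ext ((val_tradd _ _).trans (sumFibers_id _))
  add_comp f h φ := Functions.ext (by
    rw [val_tradd, val_tradd, val_tradd]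
    exact sumFibers_comp f h _)
  mul_id X φ := Functions.ext ((val_trmul _ _).trans (prodFibers_id _))
  mul_comp f h φ := Functions.ext (by
    rw [val_trmul, val_trmul, val_trmul]
    exact prodFibers_comp f h _)
  additive_empty :=
    ⟨fun _ _ => Functions.ext (funext fun x => PEmpty.elim x)⟩
  additive_sum X Y := by
    refine ⟨fun φ ψ e => Functions.ext (funext ?_), fun ⟨φ, ψ⟩ =>
      ⟨Functions.mk (X := FinGSet.sum X Y) (Sum.elim φ.val ψ.val), Prod.ext (Functions.ext ?_)
        (Functions.ext ?_)⟩⟩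
    · have h1 := congrArg Functions.val (Prod.ext_iff.1 e).1
      have h2 := congrArg Functions.val (Prod.ext_iff.1 e).2
      rw [val_res, val_res] at h1 h2
      rintro (x | x)
      · exact congrFun h1 x
      · exact congrFun h2 x
    · rw [val_res]
      exact funext fun x => congrFun (val_mk (X := FinGSet.sum X Y) (Sum.elim φ.val ψ.val))
        (FinGSet.inl X Y x)
    · rw [val_res]
      exact funext fun x => congrFun (val_mk (X := FinGSet.sum X Y) (Sum.elim φ.val ψ.val))
        (FinGSet.inr X Y x)
  mackey_add {X' Y' X Y f' x y f} sq φ := Functions.ext (by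
    rw [val_res, val_tradd, val_tradd, val_res]
    exact funext fun a => sumFibers_baseChange (f' := f') (y := y) (f := f)
      (DFunLike.congr_fun sq.w) (fun b a e => existsUnique_of_isPullback sq b a e) _ a)
  mackey_mul {X' Y' X Y f' x y f} sq φ := Functions.ext (by
    rw [val_res, val_trmul, val_trmul, val_res]
    exact funext fun a => prodFibers_baseChange (f' := f') (y := y) (f := f)
      (DFunLike.congr_fun sq.w) (fun b a e => existsUnique_of_isPullback sq b a e) _ a)
  distrib h φ := Functions.ext (by
    rw [val_trmul, val_tradd, val_tradd, val_trmul, val_res, prodFibers_sumFibers h])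

variable [Subsingleton G]

/-! ### Tambara functors on the trivial group -/

variable {T S : TambaraFunctor.{u, w} G}

theorem ext_ofPoint {X : FinGSet G} {s t : T.obj X}
    (h : ∀ x : X, T.res (ofPoint x) s = T.res (ofPoint x) t) : s = t :=
  ((multPart G).obj T).ext_ofPoint h

theorem res_ofPoint_mul {X Y : FinGSet G} (f : X ⟶ Y) (t : T.obj X) (y : Y) :
    T.res (ofPoint y) (T.mul f t) = ∏ᶠ x : {x : X // f x = y}, T.res (ofPoint x.1) t :=
  ((multPart G).obj T).res_ofPoint_tr f t y

theorem res_ofPoint_add {X Y : FinGSet G} (f : X ⟶ Y) (t : T.obj X) (y : Y) :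
    T.res (ofPoint y) (T.add f t) = ∑ᶠ x : {x : X // f x = y}, T.res (ofPoint x.1) t := by
  have := Fintype.ofFinite {x : X // f x = y}
  have h := T.addPart.res_ofPoint_tr f t y
  rw [finprod_eq_prod_of_fintype] at h
  rw [finsum_eq_sum_of_fintype]
  exact h

theorem exists_res_ofPoint {X : FinGSet G} (a : X → T.obj (point G)) :
    ∃ t : T.obj X, ∀ x, T.res (ofPoint x) t = a x :=
  ⟨_, ((multPart G).obj T).finprod_tr_ofPoint a⟩

/-- A ring homomorphism between the values at the one-point set, extended to all finite sets. -/
theorem exists_hom (g : T.obj (point G) →+* S.obj (point G)) :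
    ∃ φ : T ⟶ S, φ.app (point G) = g := by
  choose φ hφ using fun (X : FinGSet G) (t : T.obj X) =>
    exists_res_ofPoint (T := S) fun x : X => g (T.res (ofPoint x) t)
  refine ⟨Hom.mk (fun X =>
    { toFun := φ X
      map_one' := ext_ofPoint fun x => by simp only [hφ, map_one]
      map_zero' := ext_ofPoint fun x => by simp only [hφ, map_zero]
      map_mul' := fun a b => ext_ofPoint fun x => by simp only [hφ, map_mul]
      map_add' := fun a b => ext_ofPoint fun x => by simp only [hφ, map_add] })
    (fun f t => ext_ofPoint fun x => ?_) (fun f t => ext_ofPoint fun y => ?_)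
    (fun f t => ext_ofPoint fun y => ?_), ?_⟩
  · change S.res _ (φ _ (T.res f t)) = S.res _ (S.res f (φ _ t))
    rw [hφ, ← T.res_comp, ← S.res_comp, ofPoint_comp, hφ]
  · change S.res _ (φ _ (T.add f t)) = S.res _ (S.add f (φ _ t))
    rw [hφ, res_ofPoint_add, res_ofPoint_add]
    exact (map_finsum g (Set.toFinite _)).trans (finsum_congr fun x => (hφ ..).symm)
  · change S.res _ (φ _ (T.mul f t)) = S.res _ (S.mul f (φ _ t))
    rw [hφ, res_ofPoint_mul, res_ofPoint_mul]
    exact (map_finprod g (Set.toFinite _)).trans (finprod_congr fun x => (hφ ..).symm)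
  · refine RingHom.ext fun t => ?_
    have := hφ (point G) t PUnit.unit
    rw [show ofPoint (X := point G) PUnit.unit = 𝟙 (point G) from toPoint_unique _ _, S.res_id,
      T.res_id] at this
    exact this

variable (G) in
theorem isEquivalence_evRing_point : (evRing.{u, w} (point G)).IsEquivalence where
  faithful := ⟨fun {T S φ ψ} h => hom_ext fun X t => ext_ofPoint fun x => by
    have h' : φ.app (point G) = ψ.app (point G) := congrArg CommRingCat.Hom.hom h
    rw [← φ.app_res, ← ψ.app_res, h']⟩
  full := ⟨fun {T S} g => by
    obtain ⟨φ, hφ⟩ := exists_hom (T := T) (S := S) g.hom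
    exact ⟨φ, CommRingCat.hom_ext hφ⟩⟩
  essSurj := ⟨fun N => 
    have : Unique (Shrink.{w} (point G)) := (equivShrink.{w} PUnit.{u + 1}).symm.unique
    ⟨functions G N, ⟨RingEquiv.toCommRingCatIso
      (RingEquiv.piUnique (ι := Shrink.{w} (point G)) fun _ => N)⟩⟩⟩

end TambaraFunctor

namespace TambaraFunctor

variable {G : Type u} [Group G]

variable (G) in
theorem isEquivalence_evRing_regular [Finite G] [Subsingleton G] :
    (evRing.{u, w} (regular G)).IsEquivalence := by
  have := isEquivalence_evRing_point.{u, w} G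
  let i : regular G ≅ point G :=
    isoOfEquiv (X := regular G) (Y := point G)
      ⟨fun _ => PUnit.unit, fun _ => (1 : G), fun x => Subsingleton.elim (α := G) 1 x, fun _ => rfl⟩
      fun _ _ => rfl
  refine Functor.isEquivalence_of_iso (F := evRing.{u, w} (point G))
    (NatIso.ofComponents (fun T => RingEquiv.toCommRingCatIso (RingEquiv.ofRingHom
      (T.res i.hom) (T.res i.inv) (RingHom.ext fun t => ?_) (RingHom.ext fun t => ?_)))
      fun {T S} φ => CommRingCat.hom_ext (RingHom.ext fun t => (Hom.app_res φ i.hom t).symm))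
  · change T.res i.hom (T.res i.inv t) = t
    rw [← T.res_comp, i.hom_inv_id, T.res_id]
  · change T.res i.inv (T.res i.hom t) = t
    rw [← T.res_comp, i.inv_hom_id, T.res_id]

section polynomial

variable {P : TambaraFunctor.{u, w} G ⥤ TambaraFunctor.{u, w} G}
  {η : 𝟭 (TambaraFunctor.{u, w} G) ⟶ P} {E : TambaraFunctor.{u, w} G ⥤ Type w}

theorem NatBij.map_generator (b : NatBij P η E) {T : TambaraFunctor.{u, w} G} {S : Under T}
    (φ : Under.mk (Y := P.obj T) (η.app T) ⟶ S) :
    E.map φ.right (b.generator T) = b.equiv T S φ := by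
  have := b.naturality_right T _ S φ (𝟙 _)
  rw [Category.id_comp] at this
  exact this.symm

theorem NatBij.map_generator_left (b : NatBij P η E) {T T' : TambaraFunctor.{u, w} G}
    (τ : T ⟶ T') : E.map (P.map τ) (b.generator T) = b.generator T' := by
  have h := b.naturality_left τ (Under.mk (Y := P.obj T') (η.app T')) (𝟙 _)
  rw [← b.map_generator] at h
  refine .trans (congrArg (fun f => E.map f (b.generator T)) ?_) h
  exact (Category.comp_id _).symm

variable (b : NatBij P η E) {X : FinGSet G} (ι : ∀ S : TambaraFunctor.{u, w} G, E.obj S ≃ S.obj X)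

/-- The homomorphism `T(X)[x] ⟶ P(T)(X)` sending the indeterminate to the universal element. -/
noncomputable def NatBij.polynomialEval (T : TambaraFunctor.{u, w} G) :
    Polynomial (T.obj X) →+* (P.obj T).obj X :=
  Polynomial.eval₂RingHom ((η.app T).app X) (ι _ (b.generator T))

theorem NatBij.polynomialEval_C (T : TambaraFunctor.{u, w} G) (r : T.obj X) :
    b.polynomialEval ι T (Polynomial.C r) = (η.app T).app X r :=
  Polynomial.eval₂_C _ _

theorem NatBij.polynomialEval_X (T : TambaraFunctor.{u, w} G) :
    b.polynomialEval ι T Polynomial.X = ι _ (b.generator T) :=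
  Polynomial.eval₂_X _ _

theorem NatBij.bijective_polynomialEval [(evRing.{u, w} X).IsEquivalence]
    (hι : ∀ (S S' : TambaraFunctor.{u, w} G) (ψ : S ⟶ S') (s : E.obj S),
      ι S' (E.map ψ s) = ψ.app X (ι S s))
    (T : TambaraFunctor.{u, w} G) : Function.Bijective (b.polynomialEval ι T) := by
  let F := evRing.{u, w} X
  let S := F.objPreimage (CommRingCat.of (Polynomial (T.obj X)))
  let s : S.obj X ≃+* Polynomial (T.obj X) :=
    (F.objObjPreimageIso (CommRingCat.of (Polynomial (T.obj X)))).commRingCatIsoToRingEquiv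
  have hmap : ∀ {A B : TambaraFunctor.{u, w} G} (g : A.obj X →+* B.obj X),
      ∃ φ : A ⟶ B, φ.app X = g := fun {A B} g =>
    ⟨F.preimage (X := A) (Y := B) (CommRingCat.ofHom g),
      congrArg CommRingCat.Hom.hom (F.map_preimage (X := A) (Y := B) (CommRingCat.ofHom g))⟩
  obtain ⟨σ, hσ⟩ := hmap (A := T) (B := S) (s.symm.toRingHom.comp Polynomial.C)
  obtain ⟨ψ, hψ⟩ := hmap (A := S) (B := P.obj T) ((b.polynomialEval ι T).comp s.toRingHom)
  let φ : Under.mk (Y := P.obj T) (η.app T) ⟶ Under.mk σ :=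
    (b.equiv T (Under.mk σ)).symm ((ι S).symm (s.symm Polynomial.X))
  have hφ : η.app T ≫ φ.right = σ := Under.w φ
  have hφX : φ.right.app X (ι (P.obj T) (b.generator T)) = s.symm Polynomial.X := by
    refine (hι _ _ φ.right _).symm.trans ((congrArg (ι S) (b.map_generator φ)).trans ?_)
    exact (congrArg (ι S) (Equiv.apply_symm_apply _ _)).trans (Equiv.apply_symm_apply _ _)
  have hσψ : σ ≫ ψ = η.app T := F.map_injective (CommRingCat.hom_ext (RingHom.ext fun (r : T.obj X) => by
    change ψ.app X (σ.app X r) = (η.app T).app X r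
    rw [hψ, hσ, ← b.polynomialEval_C ι]
    exact congrArg (b.polynomialEval ι T) (s.apply_symm_apply _)))
  let ψ' : Under.mk σ ⟶ Under.mk (Y := P.obj T) (η.app T) := Under.homMk ψ hσψ
  have hid : φ ≫ ψ' = 𝟙 _ := by
    refine (b.equiv T _).injective ((ι _).injective ?_)
    rw [← b.map_generator]
    refine (hι _ _ (φ ≫ ψ').right _).trans ?_
    change ψ.app X (φ.right.app X (ι (P.obj T) (b.generator T))) = ι (P.obj T) (b.generator T)
    rw [hφX, hψ, ← b.polynomialEval_X ι T]
    exact congrArg (b.polynomialEval ι T) (s.apply_symm_apply _)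
  refine Function.bijective_iff_has_inverse.2 ⟨fun z => s (φ.right.app X z), fun p => ?_, fun z => ?_⟩
  · have : (s.toRingHom.comp ((φ.right.app X).comp (b.polynomialEval ι T))) = RingHom.id _ := by
      refine Polynomial.ringHom_ext (fun r => ?_) ?_
      · change s (φ.right.app X (b.polynomialEval ι T (Polynomial.C r))) = Polynomial.C r
        rw [b.polynomialEval_C]
        have h : φ.right.app X ((η.app T).app X r) = σ.app X r :=
          DFunLike.congr_fun (congrFun (congrArg Hom.app hφ) X) r
        rw [h, hσ]
        exact s.apply_symm_apply _
      · change s (φ.right.app X (b.polynomialEval ι T Polynomial.X)) = Polynomial.X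
        rw [b.polynomialEval_X, hφX]
        exact s.apply_symm_apply _
    exact DFunLike.congr_fun this p
  · have h : (φ ≫ ψ').right.app X z = z := by rw [hid]; rfl
    refine .trans ?_ h
    change _ = ψ.app X (φ.right.app X z)
    rw [hψ]
    rfl

theorem NatBij.exists_iso_polynomial [(evRing.{u, w} X).IsEquivalence]
    (hι : ∀ (S S' : TambaraFunctor.{u, w} G) (ψ : S ⟶ S') (s : E.obj S),
      ι S' (E.map ψ s) = ψ.app X (ι S s)) :
    ∃ Φ : P ⋙ evRing X ≅ evRing X ⋙ polynomialFunctor.{w}, ∀ T : TambaraFunctor.{u, w} G,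
      (∀ r : T.obj X, (Φ.hom.app T).hom ((η.app T).app X r) = Polynomial.C r) ∧
        (Φ.hom.app T).hom (ι _ (b.generator T)) = Polynomial.X := by
  let e := fun T => (RingEquiv.ofBijective _ (b.bijective_polynomialEval ι hι T))
  have he : ∀ T p, e T p = b.polynomialEval ι T p := fun _ _ => rfl
  refine ⟨NatIso.ofComponents (fun T => RingEquiv.toCommRingCatIso (e T).symm)
    fun {T T'} τ => ?_, fun T => ⟨fun r => ?_, ?_⟩⟩
  · refine CommRingCat.hom_ext (RingHom.ext fun z => ?_)
    change (e T').symm ((P.map τ).app X z) =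
      Polynomial.mapRingHom (τ.app X) ((e T).symm z)
    obtain ⟨p, rfl⟩ := (e T).surjective z
    rw [RingEquiv.symm_apply_apply, RingEquiv.symm_apply_eq, he, he]
    have : ((P.map τ).app X).comp (b.polynomialEval ι T) =
        (b.polynomialEval ι T').comp (Polynomial.mapRingHom (τ.app X)) := by
      refine Polynomial.ringHom_ext (fun r => ?_) ?_
      · change (P.map τ).app X (b.polynomialEval ι T (Polynomial.C r)) =
          b.polynomialEval ι T' (Polynomial.map (τ.app X) (Polynomial.C r))
        rw [Polynomial.map_C, b.polynomialEval_C, b.polynomialEval_C]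
        exact (DFunLike.congr_fun (congrFun (congrArg Hom.app (η.naturality τ)) X) r).symm
      · change (P.map τ).app X (b.polynomialEval ι T Polynomial.X) =
          b.polynomialEval ι T' (Polynomial.map (τ.app X) Polynomial.X)
        rw [Polynomial.map_X, b.polynomialEval_X, b.polynomialEval_X, ← hι,
          b.map_generator_left]
    exact DFunLike.congr_fun this p
  · exact (e T).symm_apply_eq.2 (b.polynomialEval_C ι T r).symm
  · exact (e T).symm_apply_eq.2 (b.polynomialEval_X ι T).symm

end polynomial

/-- For trivial `G`, all elements of `S(G/e)` are fixed. -/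
def fixedEquiv [Finite G] [Subsingleton G] (S : TambaraFunctor.{u, w} G) :
    (evFixedPoints.{u, w} G).obj S ≃ S.obj (regular G) where
  toFun s := s.1
  invFun s := ⟨s, fun g => by
    have : rightMul g = 𝟙 (regular G) := FinGSet.hom_ext fun _ => Subsingleton.elim (α := G) _ _
    rw [this]
    exact S.res_id _ s⟩
  left_inv _ := rfl
  right_inv _ := rfl

end TambaraFunctor

theorem mainTheorem3 (G : Type u) [Group G] [Finite G] :
    -- tensor products (coproducts) of Tambara functors, the Tambarization functor, and the left
    -- adjoint of `M ↦ M(G/e)^G` exist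
    ∃ (_ : HasBinaryCoproducts (TambaraFunctor.{u, w} G))
      (_ : (TambaraFunctor.multPart.{u, w} G).IsRightAdjoint)
      (_ : (SemiMackeyFunctor.evFixed.{u, w} G).IsRightAdjoint),
      -- the bijections for `T[X] = 𝓕(T, 𝔄^α)`
      (∃ b : TambaraFunctor.NatBij (TambaraFunctor.polX G) (TambaraFunctor.polXUnit G)
          (TambaraFunctor.evPoint.{u, w} G),
        -- for trivial `G`, via the equivalence `T ↦ T(G/G)` with commutative rings
        (Subsingleton G →
          (TambaraFunctor.evRing.{u, w} (FinGSet.point G)).IsEquivalence ∧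
          ∃ Φ : TambaraFunctor.polX.{u, w} G ⋙ TambaraFunctor.evRing (FinGSet.point G) ≅
              TambaraFunctor.evRing (FinGSet.point G) ⋙ polynomialFunctor.{w},
            ∀ T : TambaraFunctor.{u, w} G,
              (∀ r : T.obj (FinGSet.point G),
                (Φ.hom.app T).hom
                  (((TambaraFunctor.polXUnit G).app T).app (FinGSet.point G) r) =
                  Polynomial.C r) ∧
              (Φ.hom.app T).hom (b.generator T) = Polynomial.X)) ∧
      -- the bijections for `T[x] = 𝓕(T, 𝓛^G_ℕ)`
      (∃ b : TambaraFunctor.NatBij (TambaraFunctor.polx G) (TambaraFunctor.polxUnit G)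
          (TambaraFunctor.evFixedPoints.{u, w} G),
        -- for trivial `G`, via the equivalence `T ↦ T(G/e)` with commutative rings
        (Subsingleton G →
          (TambaraFunctor.evRing.{u, w} (FinGSet.regular G)).IsEquivalence ∧
          ∃ Φ : TambaraFunctor.polx.{u, w} G ⋙ TambaraFunctor.evRing (FinGSet.regular G) ≅
              TambaraFunctor.evRing (FinGSet.regular G) ⋙ polynomialFunctor.{w},
            ∀ T : TambaraFunctor.{u, w} G,
              (∀ r : T.obj (FinGSet.regular G),
                (Φ.hom.app T).hom
                  (((TambaraFunctor.polxUnit G).app T).app (FinGSet.regular G) r) =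
                  Polynomial.C r) ∧
              (Φ.hom.app T).hom (b.generator T).1 = Polynomial.X)) := by
  have h1 := TambaraFunctor.hasBinaryCoproducts.{u, w} G
  have h2 := TambaraFunctor.isRightAdjoint_multPart.{u, w} G
  have h3 := SemiMackeyFunctor.isRightAdjoint_evFixed.{u, w} G
  refine ⟨h1, h2, h3, ⟨TambaraFunctor.polXNatBij, fun _ => ?_⟩,
    ⟨TambaraFunctor.polxNatBij, fun _ => ?_⟩⟩
  · have he := TambaraFunctor.isEquivalence_evRing_point.{u, w} G
    exact ⟨he, TambaraFunctor.NatBij.exists_iso_polynomial (X := FinGSet.point G)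
      TambaraFunctor.polXNatBij.{u, w}
      (fun _ => Equiv.refl _) fun _ _ _ _ => rfl⟩
  · have he := TambaraFunctor.isEquivalence_evRing_regular.{u, w} G
    exact ⟨he, TambaraFunctor.NatBij.exists_iso_polynomial (X := FinGSet.regular G)
      TambaraFunctor.polxNatBij.{u, w}
      TambaraFunctor.fixedEquiv fun _ _ _ _ => rfl⟩
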